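/- Let $n,k\ge 1$. A pairwise graphical model $\mathcal D(\mathcal W,\Theta)$ on $[k]^n$ is given by matrices $W_{ij}\in\mathbb R^{k\times k}$ ($i\ne j\in[n]$) with $W_{ij}=W_{ji}^T$ and all row and column sums equal to $0$, and vectors $\theta_i\in\mathbb R^k$ ($i\in[n]$); it is the distribution with $$\Pr[Z=z]\propto\exp\Big(\sum_{i<j}W_{ij}(z_i,z_j)+\sum_i\theta_i(z_i)\Big).$$ Its dependency graph $G$ on $[n]$ has the edge set $E=\{(i,j):W_{ij}\ne 0\}$. Put $$\lambda(\mathcal W,\Theta)=\max_{i,a}\Big(\sum_{j\ne i}\max_b|W_{ij}(a,b)|+|\theta_i(a)|\Big),\qquad \eta(\mathcal W,\Theta)=\min_{(i,j)\in E}\max_{a,b}|W_{ij}(a,b)|,$$ where the minimum is $+\infty$ if $E=\emptyset$. Algorithm. Input: samples $z^1,\dots,z^N\in[k]^n$ and numbers $\lambda,\eta$. For every $i\in[n]$ and every ordered pair $\alpha\ne\beta$ in $[k]$, let $S$ be the set of samples with $z_i\in\{\alpha,\beta\}$; for $z^t\in S$ let $y^t=1$ if $z^t_i=\alpha$ and $y^t=-1$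 if $z^t_i=\beta$, and let $x^t\in\{0,1\}^{n\times k}$ be the one-hot encoding of $(z^t_{-i},1)$. Let $w^{\alpha,\beta}\in\mathbb R^{n\times k}$ be any minimizer of $\frac1{|S|}\sum_{t}\ln(1+e^{-y^t\langle w,x^t\rangle})$ subject to $\sum_j\|w(j,:)\|_2\le 2\lambda\sqrt k$ (if $S=\emptyset$, the objective is $0$). Let $U^{\alpha,\beta}$ be obtained from $w^{\alpha,\beta}$ by subtracting from each row other than that of the constant coordinate its mean, and adding the sum of these means to every entry of the row of the constant coordinate; let $U^{\alpha,\alpha}=0$. For $j\ne i$ set $\hat W_{ij}(\alpha,b)=\frac1k\sum_{\beta\in[k]}U^{\alpha,\beta}(j,b)$, where on the right $j$ stands for the row that encodes $z_j$. Output $\hat W$ and the graph $\hat G$ on $[n]$ with edges $\{(i,j): i<j,\ \max_{a,b}|\hat W_{ij}(a,b)|\ge\eta/2\}$. Claim. There is a universal constant $C>0$ such that the following holds for all $n,k$, every pairwise graphical model with $\lambda(\mathcal W,\Theta)\le\lambda$ and $\eta(\mathcal W,\Theta)\ge\eta>0$, every $\rho\in(0,1)$ and every $$N\ \ge\ C\,\frac{\lambda^2k^4e^{14\lambda}\ln(nk/\rho)}{\eta^4}.$$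 With probability at least $1-\rho$ over $N$ i.i.d. samples from $\mathcal D(\mathcal W,\Theta)$, the minimizers in the algorithm exist and, whichever of them are chosen, its output satisfies $|W_{ij}(a,b)-\hat W_{ij}(a,b)|<\eta/2$ for all $i\ne j$ and all $a,b$, and recovers the dependency graph exactly: $\hat G=G$. -/

import Mathlib

open MeasureTheory

noncomputable section

namespace PairwiseLearning

/-- The parameters `(𝒲, Θ)` of a pairwise graphical model on `n` variables over the alphabet
`Fin k`. The diagonal blocks `W i i` are not part of the model: nothing below looks at them. -/
structure Model (n k : ℕ) where
  W : Fin n → Fin n → Matrix (Fin k) (Fin k) ℝ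
  θ : Fin n → Fin k → ℝ
  symm : ∀ i j, i ≠ j → W i j = (W j i).transpose
  row_zero : ∀ i j, i ≠ j → ∀ a, ∑ b, W i j a b = 0
  col_zero : ∀ i j, i ≠ j → ∀ b, ∑ a, W i j a b = 0

/-- `max_{a,b} |A(a,b)|`. -/
def maxAbs {k : ℕ} (A : Matrix (Fin k) (Fin k) ℝ) : ℝ :=
  ⨆ p : Fin k × Fin k, |A p.1 p.2|

namespace Model

variable {n k : ℕ}

/-- The exponent `∑_{i<j} W_ij(z_i, z_j) + ∑_i θ_i(z_i)`. -/
def energy (M : Model n k) (z : Fin n → Fin k) : ℝ :=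
  (∑ i, ∑ j ∈ Finset.Ioi i, M.W i j (z i) (z j)) + ∑ i, M.θ i (z i)

/-- The distribution `𝒟(𝒲, Θ)` on `(Fin k)^n`, with mass proportional to `exp (energy z)`. -/
def dist [NeZero k] (M : Model n k) : PMF (Fin n → Fin k) :=
  PMF.normalize (fun z => ENNReal.ofReal (Real.exp (M.energy z)))
    (by
      intro h
      have h0 := ENNReal.tsum_eq_zero.mp h (fun _ => 0)
      rw [ENNReal.ofReal_eq_zero] at h0
      exact absurd h0 (not_le.mpr (Real.exp_pos _)))
    (by
      rw [tsum_fintype]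
      exact ENNReal.sum_ne_top.mpr fun _ _ => ENNReal.ofReal_ne_top)

/-- The dependency graph: `i` and `j` are adjacent iff `W_ij ≠ 0`. -/
def graph (M : Model n k) : SimpleGraph (Fin n) where
  Adj i j := i ≠ j ∧ M.W i j ≠ 0
  symm := ⟨fun i j h => ⟨h.1.symm, fun h0 => h.2 (by rw [M.symm i j h.1, h0]; rfl)⟩⟩
  loopless := ⟨fun _ h => h.1 rfl⟩

/-- The width `λ(𝒲, Θ) = max_{i,a} (∑_{j≠i} max_b |W_ij(a,b)| + |θ_i(a)|)`. -/
def width (M : Model n k) : ℝ :=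
  ⨆ p : Fin n × Fin k,
    ((∑ j ∈ Finset.univ.erase p.1, ⨆ b : Fin k, |M.W p.1 j p.2 b|) + |M.θ p.1 p.2|)

/-- The minimum edge weight `η(𝒲, Θ) = min_{(i,j) ∈ E} max_{a,b} |W_ij(a,b)|`, extended-real
valued so that the minimum over an empty edge set is `+∞`. -/
def minEdgeWeight (M : Model n k) : EReal :=
  ⨅ (i : Fin n) (j : Fin n) (_ : M.graph.Adj i j), ((maxAbs (M.W i j) : ℝ) : EReal)

end Model

variable {n k N : ℕ}

/-- One-hot encoding of a word `s` as a 0/1 matrix. -/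
def oneHot (s : Fin n → Fin k) : Matrix (Fin n) (Fin k) ℝ :=
  fun j a => if a = s j then 1 else 0

/-- The covariate of a sample in the regression for variable `i`: the one-hot encoding of the
remaining variables together with one constant coordinate. The rows are labelled so that variable
`j ≠ i` keeps row `j` and the constant coordinate (the first letter of the alphabet) takes the
vacant row `i`. -/
def covariate [NeZero k] (i : Fin n) (s : Fin n → Fin k) : Matrix (Fin n) (Fin k) ℝ :=
  oneHot (Function.update s i 0)

/-- Dot product of two matrices. -/
def dot (A B : Matrix (Fin n) (Fin k) ℝ) : ℝ := ∑ j, ∑ a, A j a * B j a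

/-- `‖w‖_{2,1} = ∑_j ‖w(j,:)‖_2`. -/
def norm21 (w : Matrix (Fin n) (Fin k) ℝ) : ℝ := ∑ j, √(∑ a, w j a ^ 2)

/-- The (indices of the) samples whose `i`-th letter is `α` or `β`. -/
def selected (z : Fin N → Fin n → Fin k) (i : Fin n) (α β : Fin k) : Finset (Fin N) :=
  Finset.univ.filter fun m => z m i = α ∨ z m i = β

/-- The label of a selected sample: `1` if its `i`-th letter is `α`, and `-1` if it is `β`. -/
def label (i : Fin n) (α : Fin k) (s : Fin n → Fin k) : ℝ := if s i = α then 1 else -1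

/-- The empirical logistic loss `(1/|S|) ∑_{t ∈ S} ln (1 + exp (-y^t ⟨w, x^t⟩))`. -/
def empiricalLoss [NeZero k] (z : Fin N → Fin n → Fin k) (i : Fin n) (α β : Fin k)
    (w : Matrix (Fin n) (Fin k) ℝ) : ℝ :=
  (1 / ((selected z i α β).card : ℝ)) * ∑ m ∈ selected z i α β,
    Real.log (1 + Real.exp (-(label i α (z m) * dot w (covariate i (z m)))))

/-- `w` is a minimizer of the empirical logistic loss subject to `‖w‖_{2,1} ≤ 2 λ √k`. -/
def IsConstrainedMinimizer [NeZero k] (lam : ℝ) (z : Fin N → Fin n → Fin k) (i : Fin n)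
    (α β : Fin k) (w : Matrix (Fin n) (Fin k) ℝ) : Prop :=
  norm21 w ≤ 2 * lam * √(k : ℝ) ∧
    ∀ v : Matrix (Fin n) (Fin k) ℝ, norm21 v ≤ 2 * lam * √(k : ℝ) →
      empiricalLoss z i α β w ≤ empiricalLoss z i α β v

/-- The matrix `U` obtained by centering all rows of `w` but the one of the constant coordinate
(row `i`), to which the removed means are added. -/
def center (i : Fin n) (w : Matrix (Fin n) (Fin k) ℝ) : Matrix (Fin n) (Fin k) ℝ :=
  fun j b =>
    if j = i then w i b + (1 / (k : ℝ)) * ∑ j' ∈ Finset.univ.erase i, ∑ a, w j' a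
    else w j b - (1 / (k : ℝ)) * ∑ a, w j a

/-- The graph with edges `{(i,j) : max_{a,b} |Ŵ_ij(a,b)| ≥ η/2, i < j}`. -/
def thresholdGraph (η : ℝ) (What : Fin n → Fin n → Matrix (Fin k) (Fin k) ℝ) :
    SimpleGraph (Fin n) :=
  SimpleGraph.fromRel fun i j => i < j ∧ η / 2 ≤ maxAbs (What i j)

/-- `(Ŵ, Ĝ)` is an output of the learning algorithm on input `z`, `λ`, `η`: for some choice of
minimizers `w^{α,β}` of the constrained logistic regressions for all `i` and all `α ≠ β`,
`Ŵ_ij(α,:) = (1/k) ∑_β U^{α,β}(j,:)` (with `U^{α,α} = 0`) for `i ≠ j`, and `Ĝ` is the thresholded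
graph. Minimizers need not be unique, so this is a relation. -/
def IsOutput [NeZero k] (lam η : ℝ) (z : Fin N → Fin n → Fin k)
    (What : Fin n → Fin n → Matrix (Fin k) (Fin k) ℝ) (Ghat : SimpleGraph (Fin n)) : Prop :=
  ∃ w : Fin n → Fin k → Fin k → Matrix (Fin n) (Fin k) ℝ,
    (∀ i α β, α ≠ β → IsConstrainedMinimizer lam z i α β (w i α β)) ∧
    (∀ i j, i ≠ j → ∀ α b,
      What i j α b = (1 / (k : ℝ)) * ∑ β ∈ Finset.univ.erase α, center i (w i α β) j b) ∧
    Ghat = thresholdGraph η What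

end PairwiseLearning

end

/-! Fix `i` and `α ≠ β`. Given that letter `i` is `α` or `β`, its label follows a logistic model
with weights `trueParam`. These weights are feasible for the constrained regression, and centring
them gives exactly `W i j α b - W i j β b`. Averaging such differences over `β` returns `W i j α b`,
because column sums vanish. So it is enough that, with high probability, no minimizer has a centred
entry exceeding the true one by more than `η / 2` (`overshoot`). A deviation in the other direction
is an overshoot of `-w` in the regression with `α` and `β` exchanged. The probabilistic input on the
model is `Model.weight_update_le`: changing one letter changes a probability by a factor of at most
`exp (2 * lam)`.

For moderate `η` the proof uses a dual certificate. The logistic loss dominates an affine function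
of any slope, at a chi-squared price (`log_one_add_exp_sub_ge`). For an entry `(j, b)` the slopes
are the true residuals plus a tilt of size `τ`, designed so that the mean of the affine bound is a
positive multiple of the overshoot at `(j, b)`, linear in `τ` (`Model.sum_certWeight_mul_dot`),
while the price is quadratic in `τ` (`Model.sum_certCost_le`). A minimizer has no larger loss than
the truth, so the overshoot is at most the price plus a fluctuation. The fluctuation pairs the
(2,1)-norm with row vectors controlled by a dimension-free Bernstein inequality
(`iidProb_norm_sum_ge_le`). Its variance is of the order of `harmTotal`, the same quantity that
multiplies the signal, so part of the dependence on the model cancels.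

The tilt must have `τ < 1`, so for large `η` this does not reach the rate `η⁻⁴`. If `η ≥ 1024 exp (4
lam)`, an overshoot makes a single entry of `w`, or the constant term, dominate the prediction on
all selected samples that contain it. A non-negligible fraction of those samples has the opposite
label, so shrinking that entry would lower the loss unless the sample counts are atypical
(`IsConstrainedMinimizer.mem_atypical`). If `η > 12 lam √k`, the norm constraint alone excludes
overshoots (`overshoot_eq_empty`). -/

noncomputable section

namespace PairwiseLearning

/-! ### Expectations over i.i.d. samples from a finite probability space -/

section Iid

variable {Ω : Type*} [Fintype Ω]

/-- The expectation of `f` over `N` independent samples from the weights `μ`. -/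
def iidExp (μ : Ω → ℝ) (N : ℕ) (f : (Fin N → Ω) → ℝ) : ℝ := ∑ z, (∏ t, μ (z t)) * f z

open Classical in
/-- The probability of `A` over `N` independent samples from the weights `μ`. -/
def iidProb (μ : Ω → ℝ) (N : ℕ) (A : Set (Fin N → Ω)) : ℝ :=
  ∑ z, if z ∈ A then ∏ t, μ (z t) else 0

lemma iidExp_succ (μ : Ω → ℝ) (N : ℕ) (f : (Fin (N + 1) → Ω) → ℝ) :
    iidExp μ (N + 1) f
      = iidExp μ N (fun z => ∑ ω, μ ω * f (Fin.cons ω z : Fin (N + 1) → Ω)) := by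
  unfold iidExp
  rw [← (Fin.consEquiv (fun _ : Fin (N + 1) => Ω)).sum_comp, Fintype.sum_prod_type,
    Finset.sum_comm]
  refine Finset.sum_congr rfl fun z _ => ?_
  rw [Finset.mul_sum]
  refine Finset.sum_congr rfl fun ω _ => ?_
  simp only [Fin.consEquiv, Equiv.coe_fn_mk, Fin.prod_univ_succ, Fin.cons_zero, Fin.cons_succ]
  ring

lemma iidExp_mono {μ : Ω → ℝ} (hμ : ∀ ω, 0 ≤ μ ω) {N : ℕ} {f g : (Fin N → Ω) → ℝ}
    (h : ∀ z, f z ≤ g z) : iidExp μ N f ≤ iidExp μ N g :=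
  Finset.sum_le_sum fun z _ =>
    mul_le_mul_of_nonneg_left (h z) (Finset.prod_nonneg fun _ _ => hμ _)

lemma iidExp_mul_const (μ : Ω → ℝ) (N : ℕ) (f : (Fin N → Ω) → ℝ) (c : ℝ) :
    iidExp μ N (fun z => f z * c) = iidExp μ N f * c := by
  unfold iidExp
  rw [Finset.sum_mul]
  exact Finset.sum_congr rfl fun z _ => by ring

lemma iidExp_exp_sum (μ : Ω → ℝ) (N : ℕ) (Y : Ω → ℝ) :
    iidExp μ N (fun z => Real.exp (∑ t, Y (z t))) = (∑ ω, μ ω * Real.exp (Y ω)) ^ N := by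
  classical
  unfold iidExp
  simp_rw [Real.exp_sum, ← Finset.prod_mul_distrib]
  rw [Fintype.sum_pow]

/-- Markov's inequality. -/
lemma iidProb_le_of_le {μ : Ω → ℝ} (hμ : ∀ ω, 0 ≤ μ ω) {N : ℕ} {A : Set (Fin N → Ω)}
    {f : (Fin N → Ω) → ℝ} (hf : ∀ z, 0 ≤ f z) {c : ℝ} (hc : 0 < c) (h : ∀ z ∈ A, c ≤ f z) :
    iidProb μ N A ≤ iidExp μ N f / c := by
  rw [le_div_iff₀ hc]
  unfold iidProb iidExp
  rw [Finset.sum_mul]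
  refine Finset.sum_le_sum fun z _ => ?_
  have hp : 0 ≤ ∏ t, μ (z t) := Finset.prod_nonneg fun _ _ => hμ _
  split_ifs with hz
  · exact mul_le_mul_of_nonneg_left (h z hz) hp
  · simpa using mul_nonneg hp (hf z)

lemma iidProb_mono {μ : Ω → ℝ} (hμ : ∀ ω, 0 ≤ μ ω) {N : ℕ} {A B : Set (Fin N → Ω)}
    (h : A ⊆ B) : iidProb μ N A ≤ iidProb μ N B := by
  refine Finset.sum_le_sum fun z _ => ?_
  have hp : 0 ≤ ∏ t, μ (z t) := Finset.prod_nonneg fun _ _ => hμ _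
  by_cases hA : z ∈ A
  · simp [hA, h hA]
  · rw [if_neg hA]; split_ifs <;> simp [hp]

lemma iidProb_iUnion_le {μ : Ω → ℝ} (hμ : ∀ ω, 0 ≤ μ ω) {N : ℕ} {ι : Type*} [Fintype ι]
    (A : ι → Set (Fin N → Ω)) {B : ℝ} (h : ∀ i, iidProb μ N (A i) ≤ B) :
    iidProb μ N (⋃ i, A i) ≤ Fintype.card ι * B := by
  classical
  calc iidProb μ N (⋃ i, A i) ≤ ∑ i, iidProb μ N (A i) := by
        unfold iidProb
        rw [Finset.sum_comm]
        refine Finset.sum_le_sum fun z _ => ?_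
        have hp : 0 ≤ ∏ t, μ (z t) := Finset.prod_nonneg fun _ _ => hμ _
        have h0 : ∀ i, (0 : ℝ) ≤ if z ∈ A i then ∏ t, μ (z t) else 0 := fun i => by
          split_ifs <;> simp [hp]
        split_ifs with hz
        · obtain ⟨i, hi⟩ := Set.mem_iUnion.mp hz
          refine le_trans ?_ (Finset.single_le_sum (fun i _ => h0 i) (Finset.mem_univ i))
          simp [hi]
        · exact Finset.sum_nonneg fun i _ => h0 i
    _ ≤ ∑ _i : ι, B := Finset.sum_le_sum fun i _ => h i
    _ = Fintype.card ι * B := by simp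

lemma iidProb_union_le {μ : Ω → ℝ} (hμ : ∀ ω, 0 ≤ μ ω) {N : ℕ} (A B : Set (Fin N → Ω)) :
    iidProb μ N (A ∪ B) ≤ iidProb μ N A + iidProb μ N B := by
  classical
  unfold iidProb
  rw [← Finset.sum_add_distrib]
  refine Finset.sum_le_sum fun z _ => ?_
  have hp : 0 ≤ ∏ t, μ (z t) := Finset.prod_nonneg fun _ _ => hμ _
  by_cases hA : z ∈ A <;> by_cases hB : z ∈ B <;> simp [hA, hB, hp]

lemma iidProb_compl {μ : Ω → ℝ} (hμ : ∑ ω, μ ω = 1) {N : ℕ} (A : Set (Fin N → Ω)) :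
    iidProb μ N Aᶜ = 1 - iidProb μ N A := by
  classical
  have h1 : ∑ z : Fin N → Ω, ∏ t, μ (z t) = 1 := by
    rw [← Fintype.sum_pow, hμ, one_pow]
  rw [eq_sub_iff_add_eq, ← h1]
  unfold iidProb
  rw [← Finset.sum_add_distrib]
  exact Finset.sum_congr rfl fun z _ => by by_cases h : z ∈ A <;> simp [h]

/-- Chernoff's bound for the upper tail. -/
lemma iidProb_sum_ge_le {μ : Ω → ℝ} (hμ : ∀ ω, 0 ≤ μ ω) (h1 : ∑ ω, μ ω = 1) (N : ℕ)
    {Y : Ω → ℝ} (h0Y : ∀ ω, 0 ≤ Y ω) (hY1 : ∀ ω, Y ω ≤ 1) {m : ℝ} (hm : ∑ ω, μ ω * Y ω ≤ m)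
    (T : ℝ) :
    iidProb μ N {z | T ≤ ∑ t, Y (z t)} ≤ Real.exp (2 * (N * m) - T) := by
  have hexp : ∀ y : ℝ, 0 ≤ y → y ≤ 1 → Real.exp y ≤ 1 + 2 * y := fun y h0 h1 => by
    have h := Real.abs_exp_sub_one_le (x := y) (by rw [abs_of_nonneg h0]; exact h1)
    rw [abs_of_nonneg h0] at h
    linarith [le_abs_self (Real.exp y - 1)]
  have hE : ∑ ω, μ ω * Real.exp (Y ω) ≤ Real.exp (2 * m) := by
    calc ∑ ω, μ ω * Real.exp (Y ω) ≤ ∑ ω, μ ω * (1 + 2 * Y ω) :=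
          Finset.sum_le_sum fun ω _ =>
            mul_le_mul_of_nonneg_left (hexp _ (h0Y ω) (hY1 ω)) (hμ ω)
      _ = 1 + 2 * ∑ ω, μ ω * Y ω := by
          simp only [mul_add, mul_one, Finset.sum_add_distrib, h1, Finset.mul_sum]
          exact congrArg _ (Finset.sum_congr rfl fun ω _ => by ring)
      _ ≤ Real.exp (2 * m) := by linarith [Real.add_one_le_exp (2 * m)]
  calc iidProb μ N {z | T ≤ ∑ t, Y (z t)}
      ≤ iidExp μ N (fun z => Real.exp (∑ t, Y (z t))) / Real.exp T :=
        iidProb_le_of_le hμ (fun z => (Real.exp_pos _).le) (Real.exp_pos T)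
          (fun z hz => Real.exp_le_exp.mpr hz)
    _ ≤ (Real.exp (2 * m)) ^ N / Real.exp T := by
        rw [iidExp_exp_sum]
        gcongr
        exact Finset.sum_nonneg fun ω _ => mul_nonneg (hμ ω) (Real.exp_pos _).le
    _ = Real.exp (2 * (N * m) - T) := by
        rw [← Real.exp_nat_mul, Real.exp_sub]; ring_nf

/-- Chernoff's bound for the lower tail. -/
lemma iidProb_sum_le_le {μ : Ω → ℝ} (hμ : ∀ ω, 0 ≤ μ ω) (h1 : ∑ ω, μ ω = 1) (N : ℕ)
    {Y : Ω → ℝ} (h0Y : ∀ ω, 0 ≤ Y ω) (hY1 : ∀ ω, Y ω ≤ 1) {m : ℝ} (hm : m ≤ ∑ ω, μ ω * Y ω)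
    (T : ℝ) :
    iidProb μ N {z | ∑ t, Y (z t) ≤ T} ≤ Real.exp (T - 5 / 8 * (N * m)) := by
  -- The chord of `exp (-y)` on `[0, 1]` then has slope at most `-5/8`. What matters is `5/8 > 1/2`:
  -- falling below half the mean costs `exp (-mean / 8)`.
  have he1 : Real.exp (-1) ≤ 3 / 8 := by
    rw [Real.exp_neg, inv_le_comm₀ (Real.exp_pos _) (by norm_num)]
    linarith [Real.exp_one_gt_d9]
  have hexp : ∀ y : ℝ, 0 ≤ y → y ≤ 1 → Real.exp (-y) ≤ 1 - 5 / 8 * y := fun y h0 h1 => by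
    have h := convexOn_exp.2 (Set.mem_univ 0) (Set.mem_univ (-1)) (sub_nonneg.mpr h1) h0
      (by ring)
    simp only [smul_eq_mul, mul_zero, zero_add, Real.exp_zero, mul_neg, mul_one] at h
    nlinarith
  have hE : ∑ ω, μ ω * Real.exp (-Y ω) ≤ Real.exp (-(5 / 8 * m)) := by
    calc ∑ ω, μ ω * Real.exp (-Y ω) ≤ ∑ ω, μ ω * (1 - 5 / 8 * Y ω) :=
          Finset.sum_le_sum fun ω _ =>
            mul_le_mul_of_nonneg_left (hexp _ (h0Y ω) (hY1 ω)) (hμ ω)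
      _ = 1 - 5 / 8 * ∑ ω, μ ω * Y ω := by
          simp only [mul_sub, mul_one, Finset.sum_sub_distrib, h1, Finset.mul_sum]
          exact congrArg _ (Finset.sum_congr rfl fun ω _ => by ring)
      _ ≤ Real.exp (-(5 / 8 * m)) := by linarith [Real.add_one_le_exp (-(5 / 8 * m))]
  calc iidProb μ N {z | ∑ t, Y (z t) ≤ T}
      ≤ iidExp μ N (fun z => Real.exp (∑ t, -Y (z t))) / Real.exp (-T) :=
        iidProb_le_of_le hμ (fun z => (Real.exp_pos _).le) (Real.exp_pos (-T))
          (fun z hz => Real.exp_le_exp.mpr (by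
            rw [Finset.sum_neg_distrib]; exact neg_le_neg hz))
    _ ≤ (Real.exp (-(5 / 8 * m))) ^ N / Real.exp (-T) := by
        rw [iidExp_exp_sum μ N (fun ω => -Y ω)]
        gcongr
        exact Finset.sum_nonneg fun ω _ => mul_nonneg (hμ ω) (Real.exp_pos _).le
    _ = Real.exp (T - 5 / 8 * (N * m)) := by
        rw [← Real.exp_nat_mul, ← Real.exp_sub]; ring_nf

end Iid

/-! ### A Bernstein inequality in Hilbert space -/

/-- `cosh ∘ sqrt` is convex. -/
lemma cosh_sqrt_le {p q θ : ℝ} (hp : 0 ≤ p) (hq : 0 ≤ q) (h0 : 0 ≤ θ) (h1 : θ ≤ 1) :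
    Real.cosh √(θ * p + (1 - θ) * q)
      ≤ θ * Real.cosh √p + (1 - θ) * Real.cosh √q := by
  have hr : 0 ≤ θ * p + (1 - θ) * q :=
    add_nonneg (mul_nonneg h0 hp) (mul_nonneg (sub_nonneg.mpr h1) hq)
  -- `cosh √t = ∑ tⁿ / (2n)!` has nonnegative coefficients, so convexity holds term by term.
  refine hasSum_le (fun n => ?_) (Real.hasSum_cosh _)
    (((Real.hasSum_cosh √p).mul_left θ).add ((Real.hasSum_cosh √q).mul_left (1 - θ)))
  rw [pow_mul, pow_mul, pow_mul, Real.sq_sqrt hp, Real.sq_sqrt hq, Real.sq_sqrt hr]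
  have h := (convexOn_pow n).2 (Set.mem_Ici.mpr hp) (Set.mem_Ici.mpr hq) h0
    (sub_nonneg.mpr h1) (by ring)
  simp only [smul_eq_mul] at h
  rw [← mul_div_assoc, ← mul_div_assoc, ← add_div]
  gcongr

lemma self_le_sinh {b : ℝ} (hb : 0 ≤ b) : b ≤ Real.sinh b := Real.self_le_sinh_iff.mpr hb

section Hilbert

variable {H : Type*} [NormedAddCommGroup H] [InnerProductSpace ℝ H]

/-- A second-order expansion of `cosh ‖x + v‖` around `x`. -/
lemma cosh_norm_add_le (x v : H) :
    Real.cosh ‖x + v‖ ≤ Real.cosh ‖x‖ * (Real.exp ‖v‖ - ‖v‖)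
      + Real.sinh ‖x‖ / ‖x‖ * inner ℝ x v := by
  set a := ‖x‖ with ha
  set b := ‖v‖ with hb
  have ha0 : 0 ≤ a := norm_nonneg x
  have hb0 : 0 ≤ b := norm_nonneg v
  set c := inner ℝ x v with hc
  have habs : |c| ≤ a * b := abs_real_inner_le_norm x v
  have hsq : ‖x + v‖ = √(a ^ 2 + 2 * c + b ^ 2) := by
    rw [← norm_add_sq_real x v, Real.sqrt_sq (norm_nonneg _)]
  have hsc : Real.sinh a ≤ Real.cosh a := (Real.sinh_lt_cosh a).le
  have hs0 : 0 ≤ Real.sinh a := Real.sinh_nonneg_iff.mpr ha0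
  have hsb : b ≤ Real.sinh b := self_le_sinh hb0
  have hcb : 1 ≤ Real.cosh b := Real.one_le_cosh b
  have he : Real.exp b = Real.cosh b + Real.sinh b := (Real.cosh_add_sinh b).symm
  rcases eq_or_lt_of_le (mul_nonneg ha0 hb0) with h0 | hpos
  · have hc0 : c = 0 := by
      rw [← h0] at habs; exact abs_eq_zero.mp (le_antisymm habs (abs_nonneg c))
    rw [hsq, hc0, he]
    rcases mul_eq_zero.mp h0.symm with h | h
    · rw [h]; simp only [Real.cosh_zero, Real.sinh_zero]
      norm_num
      rw [Real.sqrt_sq hb0]; linarith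
    · rw [h]; simp only [Real.cosh_zero, Real.sinh_zero]
      norm_num
      rw [Real.sqrt_sq ha0]
  · have ha' : 0 < a := lt_of_le_of_ne ha0 fun h => by rw [← h] at hpos; simp at hpos
    have hb' : 0 < b := lt_of_le_of_ne hb0 fun h => by rw [← h] at hpos; simp at hpos
    obtain ⟨hl, hu⟩ := abs_le.mp habs
    -- `‖x + v‖²` is the convex combination of `(a + b)²` and `(a - b)²` with weight `θ`, and `θ` is
    -- affine in the inner product `c`. Convexity of `cosh ∘ sqrt` thus gives a bound affine in `c`.
    set θ := (a * b + c) / (2 * (a * b)) with hθ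
    have hθ0 : 0 ≤ θ := div_nonneg (by linarith) (by linarith)
    have hθ1 : θ ≤ 1 := by rw [hθ, div_le_one (by linarith)]; linarith
    have hcθ : c = a * b * (2 * θ - 1) := by rw [hθ]; field_simp; ring
    have hconv := cosh_sqrt_le (sq_nonneg (a + b)) (sq_nonneg (a - b)) hθ0 hθ1
    have harg : θ * (a + b) ^ 2 + (1 - θ) * (a - b) ^ 2 = a ^ 2 + 2 * c + b ^ 2 := by
      rw [hcθ]; ring
    rw [harg, Real.sqrt_sq (add_nonneg ha0 hb0), Real.sqrt_sq_eq_abs, Real.cosh_abs,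
      Real.cosh_add, Real.cosh_sub] at hconv
    have hfrac : Real.sinh a / a * c = Real.sinh a * b * (2 * θ - 1) := by
      rw [hcθ]; field_simp
    rw [hsq, hfrac, he]
    refine hconv.trans ?_
    nlinarith [mul_nonneg (mul_nonneg hs0 (sub_nonneg.mpr hsb)) (sub_nonneg.mpr hθ1),
      mul_nonneg (sub_nonneg.mpr hsc) (sub_nonneg.mpr hsb)]

variable {Ω : Type*} [Fintype Ω]

/-- In the expansion of `cosh ‖x + V‖` the linear term has mean zero, and `exp t - t ≤ 1 + t²` on
`[0, 1]`. Each new sample therefore multiplies the expectation by at most `exp v`, whatever the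
dimension of `H`. -/
lemma iidExp_cosh_le {μ : Ω → ℝ} (hμ : ∀ ω, 0 ≤ μ ω) (h1 : ∑ ω, μ ω = 1) (V : Ω → H)
    (h0 : ∑ ω, μ ω • V ω = 0) (hV : ∀ ω, ‖V ω‖ ≤ 1) {v : ℝ} (hv : ∑ ω, μ ω * ‖V ω‖ ^ 2 ≤ v)
    (N : ℕ) :
    iidExp μ N (fun z => Real.cosh ‖∑ t, V (z t)‖) ≤ Real.exp (N * v) := by
  have hexp : ∀ ω, Real.exp ‖V ω‖ - ‖V ω‖ ≤ 1 + ‖V ω‖ ^ 2 := fun ω => by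
    have h := Real.abs_exp_sub_one_sub_id_le (x := ‖V ω‖) (by rw [abs_norm]; exact hV ω)
    linarith [le_abs_self (Real.exp ‖V ω‖ - 1 - ‖V ω‖)]
  have step : ∀ x : H, ∑ ω, μ ω * Real.cosh ‖V ω + x‖ ≤ Real.cosh ‖x‖ * Real.exp v := by
    intro x
    calc ∑ ω, μ ω * Real.cosh ‖V ω + x‖
        ≤ ∑ ω, μ ω * (Real.cosh ‖x‖ * (1 + ‖V ω‖ ^ 2)
            + Real.sinh ‖x‖ / ‖x‖ * inner ℝ x (V ω)) := by
          refine Finset.sum_le_sum fun ω _ => mul_le_mul_of_nonneg_left ?_ (hμ ω)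
          rw [add_comm (V ω)]
          refine (cosh_norm_add_le x (V ω)).trans ?_
          gcongr
          · exact hexp ω
      _ = Real.cosh ‖x‖ * (1 + ∑ ω, μ ω * ‖V ω‖ ^ 2)
            + Real.sinh ‖x‖ / ‖x‖ * inner ℝ x (∑ ω, μ ω • V ω) := by
          have h : ∀ ω, μ ω * (Real.cosh ‖x‖ * (1 + ‖V ω‖ ^ 2)
              + Real.sinh ‖x‖ / ‖x‖ * inner ℝ x (V ω))
              = Real.cosh ‖x‖ * (μ ω + μ ω * ‖V ω‖ ^ 2)
                + Real.sinh ‖x‖ / ‖x‖ * inner ℝ x (μ ω • V ω) := fun ω => by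
            rw [real_inner_smul_right]; ring
          simp_rw [h, Finset.sum_add_distrib, ← Finset.mul_sum, Finset.sum_add_distrib, h1,
            inner_sum]
      _ ≤ Real.cosh ‖x‖ * Real.exp v := by
          rw [h0, inner_zero_right, mul_zero, add_zero]
          have := Real.add_one_le_exp v
          have := Real.cosh_pos ‖x‖
          gcongr
          linarith
  induction N with
  | zero => simp [iidExp]
  | succ N ih =>
    rw [iidExp_succ]
    calc iidExp μ N (fun z => ∑ ω, μ ω *
            Real.cosh ‖∑ t, V ((Fin.cons ω z : Fin (N + 1) → Ω) t)‖)
        ≤ iidExp μ N (fun z => Real.cosh ‖∑ t, V (z t)‖ * Real.exp v) := by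
          refine iidExp_mono hμ fun z => ?_
          simp only [Fin.sum_univ_succ, Fin.cons_zero, Fin.cons_succ]
          exact step _
      _ = iidExp μ N (fun z => Real.cosh ‖∑ t, V (z t)‖) * Real.exp v :=
          iidExp_mul_const _ _ _ _
      _ ≤ Real.exp (N * v) * Real.exp v := by gcongr
      _ = Real.exp ((N + 1 : ℕ) * v) := by
          rw [← Real.exp_add]; push_cast; ring_nf

/-- Bernstein's inequality for sums of independent centred vectors of norm at most `2`. -/
lemma iidProb_norm_sum_ge_le {μ : Ω → ℝ} (hμ : ∀ ω, 0 ≤ μ ω) (h1 : ∑ ω, μ ω = 1) (V : Ω → H)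
    (h0 : ∑ ω, μ ω • V ω = 0) (hV : ∀ ω, ‖V ω‖ ≤ 2) {v : ℝ} (hv0 : 0 < v)
    (hv : ∑ ω, μ ω * ‖V ω‖ ^ 2 ≤ v) {N : ℕ} (hN : 0 < N) {d : ℝ} (hd0 : 0 ≤ d)
    (hd : d ≤ N * v) :
    iidProb μ N {z | d ≤ ‖∑ t, V (z t)‖} ≤ 2 * Real.exp (-(d ^ 2 / (4 * (N * v)))) := by
  have hNv : 0 < N * v := mul_pos (Nat.cast_pos.mpr hN) hv0
  -- This `s` maximizes `s d - N s² v`. The hypothesis `hd` makes `s ≤ 1 / 2`, so that `s • V` stays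
  -- in the unit ball.
  set s := d / (2 * (N * v)) with hs
  have hs0 : 0 ≤ s := by positivity
  have hs1 : s ≤ 1 / 2 := by
    rw [hs, div_le_iff₀ (by positivity)]; linarith
  have hE := iidExp_cosh_le hμ h1 (fun ω => s • V ω)
    (by simp_rw [smul_comm _ s]; rw [← Finset.smul_sum, h0, smul_zero])
    (fun ω => by
      rw [norm_smul, Real.norm_of_nonneg hs0]
      nlinarith [hV ω, norm_nonneg (V ω)])
    (v := s ^ 2 * v)
    (by
      calc ∑ ω, μ ω * ‖s • V ω‖ ^ 2 = s ^ 2 * ∑ ω, μ ω * ‖V ω‖ ^ 2 := by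
            rw [Finset.mul_sum]
            refine Finset.sum_congr rfl fun ω _ => ?_
            rw [norm_smul, Real.norm_of_nonneg hs0]; ring
        _ ≤ s ^ 2 * v := by gcongr) N
  calc iidProb μ N {z | d ≤ ‖∑ t, V (z t)‖}
      ≤ iidExp μ N (fun z => Real.cosh ‖∑ t, s • V (z t)‖) / (Real.exp (s * d) / 2) := by
        refine iidProb_le_of_le hμ (fun z => (Real.cosh_pos _).le) (by positivity) ?_
        intro z hz
        rw [← Finset.smul_sum, norm_smul, Real.norm_of_nonneg hs0, Real.cosh_eq]
        have : Real.exp (s * d) ≤ Real.exp (s * ‖∑ t, V (z t)‖) :=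
          Real.exp_le_exp.mpr (mul_le_mul_of_nonneg_left hz hs0)
        linarith [Real.exp_pos (-(s * ‖∑ t, V (z t)‖))]
    _ ≤ Real.exp (N * (s ^ 2 * v)) / (Real.exp (s * d) / 2) := by gcongr
    _ = 2 * Real.exp (-(d ^ 2 / (4 * (N * v)))) := by
        rw [div_div_eq_mul_div, mul_comm _ (2 : ℝ), mul_div_assoc, ← Real.exp_sub]
        congr 2
        rw [hs]; field_simp; ring

end Hilbert

section

/-! ### The weights of a pairwise model -/

namespace Model

variable {n k : ℕ}

/-- The probability mass of `z` as a real number. -/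
def weight (M : Model n k) (z : Fin n → Fin k) : ℝ :=
  Real.exp (M.energy z) / ∑ y, Real.exp (M.energy y)

/-- The part of the energy that depends on variable `j`, when that variable takes the value `a`. -/
def localField (M : Model n k) (j : Fin n) (z : Fin n → Fin k) (a : Fin k) : ℝ :=
  (∑ l ∈ Finset.univ.erase j, M.W j l a (z l)) + M.θ j a

lemma sum_exp_pos [NeZero k] (M : Model n k) : 0 < ∑ y, Real.exp (M.energy y) :=
  Finset.sum_pos (fun _ _ => Real.exp_pos _) ⟨fun _ => 0, Finset.mem_univ _⟩

lemma weight_pos [NeZero k] (M : Model n k) (z : Fin n → Fin k) : 0 < M.weight z :=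
  div_pos (Real.exp_pos _) M.sum_exp_pos

lemma sum_weight [NeZero k] (M : Model n k) : ∑ z, M.weight z = 1 := by
  unfold weight
  rw [← Finset.sum_div, div_self M.sum_exp_pos.ne']

/-- Only pairs containing `j` change. Pairs `i < j` appear in the energy through column `j`; the
symmetry of `W` moves them to row `j`. -/
lemma energy_update_sub (M : Model n k) (j : Fin n) (z : Fin n → Fin k) (a b : Fin k) :
    M.energy (Function.update z j a) - M.energy (Function.update z j b)
      = M.localField j z a - M.localField j z b := by
  set y := Function.update z j a with hy
  set x := Function.update z j b with hx
  have hyj : y j = a := by simp [hy]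
  have hxj : x j = b := by simp [hx]
  have hyl : ∀ l, l ≠ j → y l = z l := fun l h => by simp [hy, h]
  have hxl : ∀ l, l ≠ j → x l = z l := fun l h => by simp [hx, h]
  set F : Fin n → Fin n → ℝ := fun i l => M.W i l (y i) (y l) - M.W i l (x i) (x l) with hF
  have hF0 : ∀ i l, i ≠ j → l ≠ j → F i l = 0 := fun i l hi hl => by
    simp [hF, hyl _ hi, hyl _ hl, hxl _ hi, hxl _ hl]
  have hFs : ∀ i, i ≠ j → F i j = F j i := fun i hi => by
    simp only [hF, M.symm i j hi, Matrix.transpose_apply]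
  have hθ : ∑ i, M.θ i (y i) - ∑ i, M.θ i (x i) = M.θ j a - M.θ j b := by
    rw [← Finset.sum_sub_distrib, Finset.sum_eq_single j]
    · rw [hyj, hxj]
    · intro l _ hl; rw [hyl l hl, hxl l hl, sub_self]
    · simp
  have hrow : ∀ i, i ≠ j → ∑ l ∈ Finset.Ioi i, F i l = if i < j then F j i else 0 := by
    intro i hi
    split_ifs with hij
    · rw [Finset.sum_eq_single j, hFs i hi]
      · intro l _ hl; exact hF0 i l hi hl
      · intro h; exact absurd (Finset.mem_Ioi.mpr hij) h
    · refine Finset.sum_eq_zero fun l hl => hF0 i l hi ?_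
      rintro rfl
      exact hij (Finset.mem_Ioi.mp hl)
  have hsum : ∑ i, ∑ l ∈ Finset.Ioi i, F i l = ∑ l ∈ Finset.univ.erase j, F j l := by
    rw [← Finset.add_sum_erase _ _ (Finset.mem_univ j),
      Finset.sum_congr rfl fun i hi => hrow i (Finset.ne_of_mem_erase hi)]
    have h1 : Finset.Ioi j = (Finset.univ.erase j).filter fun l => j < l := by
      ext l; simp only [Finset.mem_Ioi, Finset.mem_filter, Finset.mem_erase, Finset.mem_univ,
        and_true]
      exact ⟨fun h => ⟨h.ne', h⟩, fun h => h.2⟩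
    rw [h1, Finset.sum_filter, ← Finset.sum_add_distrib]
    refine Finset.sum_congr rfl fun l hl => ?_
    rcases lt_or_gt_of_ne (Finset.ne_of_mem_erase hl) with h | h
    · simp [h, h.le]
    · simp [h, h.le]
  have hFj : ∑ l ∈ Finset.univ.erase j, F j l
      = ∑ l ∈ Finset.univ.erase j, M.W j l a (z l)
        - ∑ l ∈ Finset.univ.erase j, M.W j l b (z l) := by
    rw [← Finset.sum_sub_distrib]
    refine Finset.sum_congr rfl fun l hl => ?_
    have := Finset.ne_of_mem_erase hl
    simp only [hF, hyj, hxj, hyl l this, hxl l this]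
  have hE : M.energy y - M.energy x
      = ∑ i, ∑ l ∈ Finset.Ioi i, F i l + (∑ i, M.θ i (y i) - ∑ i, M.θ i (x i)) := by
    simp only [energy, hF, Finset.sum_sub_distrib]
    ring
  rw [hE, hsum, hFj, hθ]
  unfold localField
  ring

lemma abs_le_iSup (f : Fin k → ℝ) (b : Fin k) : |f b| ≤ ⨆ b, |f b| :=
  le_ciSup (f := fun b => |f b|) (Set.finite_range _).bddAbove b

lemma sum_iSup_add_le (M : Model n k) {lam : ℝ} (h : M.width ≤ lam) (i : Fin n) (a : Fin k) :
    (∑ j ∈ Finset.univ.erase i, ⨆ b : Fin k, |M.W i j a b|) + |M.θ i a| ≤ lam :=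
  (le_ciSup (f := fun p : Fin n × Fin k =>
    ((∑ j ∈ Finset.univ.erase p.1, ⨆ b : Fin k, |M.W p.1 j p.2 b|) + |M.θ p.1 p.2|))
    (Set.finite_range _).bddAbove (i, a)).trans h

lemma nonneg_of_width_le [NeZero k] (M : Model n k) {lam : ℝ} (h : M.width ≤ lam) (i : Fin n) :
    0 ≤ lam := by
  refine le_trans ?_ (M.sum_iSup_add_le h i 0)
  exact add_nonneg (Finset.sum_nonneg fun j _ => Real.iSup_nonneg fun b => abs_nonneg _)
    (abs_nonneg _)

lemma abs_W_le [NeZero k] (M : Model n k) {lam : ℝ} (h : M.width ≤ lam) {i j : Fin n}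
    (hij : j ≠ i) (a b : Fin k) : |M.W i j a b| ≤ lam := by
  refine le_trans ?_ (M.sum_iSup_add_le h i a)
  refine (abs_le_iSup (M.W i j a) b).trans (le_trans ?_ (le_add_of_nonneg_right (abs_nonneg _)))
  exact Finset.single_le_sum (f := fun j => ⨆ b : Fin k, |M.W i j a b|)
    (fun j _ => Real.iSup_nonneg fun b => abs_nonneg _)
    (Finset.mem_erase.mpr ⟨hij, Finset.mem_univ j⟩)

lemma abs_localField_le (M : Model n k) {lam : ℝ} (h : M.width ≤ lam) (j : Fin n)
    (z : Fin n → Fin k) (a : Fin k) : |M.localField j z a| ≤ lam := by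
  refine le_trans ?_ (M.sum_iSup_add_le h j a)
  refine (abs_add_le _ _).trans (add_le_add_left ?_ _)
  exact (Finset.abs_sum_le_sum_abs _ _).trans
    (Finset.sum_le_sum fun l _ => abs_le_iSup (M.W j l a) (z l))

lemma weight_update_eq (M : Model n k) (j : Fin n) (z : Fin n → Fin k) (a b : Fin k) :
    M.weight (Function.update z j a)
      = Real.exp (M.localField j z a - M.localField j z b)
        * M.weight (Function.update z j b) := by
  unfold weight
  rw [← M.energy_update_sub, ← mul_div_assoc, ← Real.exp_add, sub_add_cancel]

/-- The local fields lie in `[-lam, lam]`, so a log-ratio of two probabilities that differ in one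
letter is at most `2 * lam`. The later lower bounds on masses come from this comparison. -/
lemma weight_update_le (M : Model n k) {lam : ℝ} (h : M.width ≤ lam) [NeZero k] (j : Fin n)
    (z : Fin n → Fin k) (a : Fin k) :
    M.weight (Function.update z j a) ≤ Real.exp (2 * lam) * M.weight z := by
  have h1 := M.weight_update_eq j z a (z j)
  rw [Function.update_eq_self] at h1
  rw [h1]
  refine mul_le_mul_of_nonneg_right (Real.exp_le_exp.mpr ?_) (M.weight_pos z).le
  have h2 := abs_le.mp (M.abs_localField_le h j z a)
  have h3 := abs_le.mp (M.abs_localField_le h j z (z j))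
  linarith

/-- The weights of the logistic regression that predicts whether `z i` is `α` or `β`. -/
def trueParam [NeZero k] (M : Model n k) (i : Fin n) (α β : Fin k) :
    Matrix (Fin n) (Fin k) ℝ := fun l b =>
  if l = i then (if b = 0 then M.θ i α - M.θ i β else 0) else M.W i l α b - M.W i l β b

end Model

variable {n k : ℕ}

lemma dot_covariate [NeZero k] (i : Fin n) (w : Matrix (Fin n) (Fin k) ℝ) (z : Fin n → Fin k) :
    dot w (covariate i z) = ∑ l, w l (Function.update z i 0 l) := by
  unfold dot covariate oneHot
  refine Finset.sum_congr rfl fun l _ => ?_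
  simp

namespace Model

/-- The value is the conditional log-odds of `α` against `β` given the other variables. -/
lemma dot_trueParam [NeZero k] (M : Model n k) (i : Fin n) (α β : Fin k) (z : Fin n → Fin k) :
    dot (M.trueParam i α β) (covariate i z) = M.localField i z α - M.localField i z β := by
  rw [dot_covariate, ← Finset.add_sum_erase _ _ (Finset.mem_univ i)]
  have h : ∀ l ∈ Finset.univ.erase i, M.trueParam i α β l (Function.update z i 0 l)
      = M.W i l α (z l) - M.W i l β (z l) := fun l hl => by
    simp [trueParam, Finset.ne_of_mem_erase hl]
  rw [Finset.sum_congr rfl h, Finset.sum_sub_distrib]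
  simp only [trueParam, localField, if_true, Function.update_self]
  ring

lemma weight_update_eq_exp_dot [NeZero k] (M : Model n k) (i : Fin n) (α β : Fin k)
    (z : Fin n → Fin k) :
    M.weight (Function.update z i α)
      = Real.exp (dot (M.trueParam i α β) (covariate i z)) * M.weight (Function.update z i β) := by
  rw [dot_trueParam, ← weight_update_eq]

/-- Makes the true weights a competitor in the regression. A row norm is at most `√k` times its
largest entry, and the widths at `α` and at `β` each contribute `lam`. -/
lemma norm21_trueParam_le [NeZero k] (M : Model n k) {lam : ℝ} (h : M.width ≤ lam) (i : Fin n)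
    (α β : Fin k) : norm21 (M.trueParam i α β) ≤ 2 * lam * √(k : ℝ) := by
  have hk : (1 : ℝ) ≤ √(k : ℝ) := by
    rw [Real.one_le_sqrt]; exact_mod_cast NeZero.one_le
  have hrow : ∀ l ∈ Finset.univ.erase i, √(∑ a, M.trueParam i α β l a ^ 2)
      ≤ ((⨆ b, |M.W i l α b|) + ⨆ b, |M.W i l β b|) * √(k : ℝ) := by
    intro l hl
    have h0 : 0 ≤ (⨆ b, |M.W i l α b|) + ⨆ b, |M.W i l β b| :=
      add_nonneg (Real.iSup_nonneg fun _ => abs_nonneg _)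
        (Real.iSup_nonneg fun _ => abs_nonneg _)
    rw [← Real.sqrt_sq h0, ← Real.sqrt_mul (sq_nonneg _)]
    refine Real.sqrt_le_sqrt ?_
    calc ∑ a, M.trueParam i α β l a ^ 2
        ≤ ∑ _a : Fin k, ((⨆ b, |M.W i l α b|) + ⨆ b, |M.W i l β b|) ^ 2 := by
          refine Finset.sum_le_sum fun a _ => sq_le_sq' ?_ ?_
          all_goals
            have h1 := abs_le.mp (abs_le_iSup (M.W i l α) a)
            have h2 := abs_le.mp (abs_le_iSup (M.W i l β) a)
            simp only [trueParam, Finset.ne_of_mem_erase hl, if_false]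
            linarith
      _ = _ := by simp [mul_comm]
  have hi : √(∑ a, M.trueParam i α β i a ^ 2) ≤ (|M.θ i α| + |M.θ i β|) * √(k : ℝ) := by
    have h1 : ∑ a, M.trueParam i α β i a ^ 2 = (M.θ i α - M.θ i β) ^ 2 := by
      rw [Finset.sum_eq_single 0]
      · simp [trueParam]
      · intro b _ hb; simp [trueParam, hb]
      · simp
    rw [h1, Real.sqrt_sq_eq_abs]
    have := abs_sub (M.θ i α) (M.θ i β)
    nlinarith [abs_nonneg (M.θ i α), abs_nonneg (M.θ i β)]
  unfold norm21
  rw [← Finset.add_sum_erase _ _ (Finset.mem_univ i)]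
  calc _ ≤ (|M.θ i α| + |M.θ i β|) * √(k : ℝ) + ∑ l ∈ Finset.univ.erase i,
            ((⨆ b, |M.W i l α b|) + ⨆ b, |M.W i l β b|) * √(k : ℝ) :=
        add_le_add hi (Finset.sum_le_sum hrow)
    _ = (((∑ j ∈ Finset.univ.erase i, ⨆ b : Fin k, |M.W i j α b|) + |M.θ i α|)
          + ((∑ j ∈ Finset.univ.erase i, ⨆ b : Fin k, |M.W i j β b|) + |M.θ i β|))
            * √(k : ℝ) := by
        rw [← Finset.sum_mul, Finset.sum_add_distrib]; ring
    _ ≤ 2 * lam * √(k : ℝ) := by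
        have h1 := M.sum_iSup_add_le h i α
        have h2 := M.sum_iSup_add_le h i β
        gcongr
        linarith

lemma center_trueParam [NeZero k] (M : Model n k) {i j : Fin n} (hij : j ≠ i) (α β b : Fin k) :
    center i (M.trueParam i α β) j b = M.W i j α b - M.W i j β b := by
  simp [center, trueParam, hij, Finset.sum_sub_distrib, M.row_zero i j hij.symm]

end Model

/-! ### Centring and the (2,1)-norm -/

lemma center_sub {i j : Fin n} (hij : j ≠ i) (w v : Matrix (Fin n) (Fin k) ℝ) (b : Fin k) :
    center i (w - v) j b = center i w j b - center i v j b := by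
  simp only [center, hij, if_false, Matrix.sub_apply, Finset.sum_sub_distrib]
  ring

lemma center_neg {i j : Fin n} (hij : j ≠ i) (w : Matrix (Fin n) (Fin k) ℝ) (b : Fin k) :
    center i (-w) j b = -center i w j b := by
  simp only [center, hij, if_false, Matrix.neg_apply, Finset.sum_neg_distrib]
  ring

lemma sqrt_row_le_norm21 (w : Matrix (Fin n) (Fin k) ℝ) (j : Fin n) :
    √(∑ a, w j a ^ 2) ≤ norm21 w :=
  Finset.single_le_sum (f := fun j => √(∑ a, w j a ^ 2)) (fun _ _ => Real.sqrt_nonneg _)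
    (Finset.mem_univ j)

lemma abs_le_norm21 (w : Matrix (Fin n) (Fin k) ℝ) (j : Fin n) (b : Fin k) :
    |w j b| ≤ norm21 w := by
  refine le_trans ?_ (sqrt_row_le_norm21 w j)
  rw [← Real.sqrt_sq_eq_abs]
  exact Real.sqrt_le_sqrt (Finset.single_le_sum (f := fun a => w j a ^ 2)
    (fun _ _ => sq_nonneg _) (Finset.mem_univ b))

lemma norm21_neg (w : Matrix (Fin n) (Fin k) ℝ) : norm21 (-w) = norm21 w := by
  simp [norm21]

lemma norm21_eq_sum_norm (w : Matrix (Fin n) (Fin k) ℝ) :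
    norm21 w = ∑ j, ‖WithLp.toLp 2 (w j)‖ := by
  simp [norm21, EuclideanSpace.norm_eq]

lemma norm21_sub_le (w v : Matrix (Fin n) (Fin k) ℝ) :
    norm21 (w - v) ≤ norm21 w + norm21 v := by
  rw [norm21_eq_sum_norm, norm21_eq_sum_norm, norm21_eq_sum_norm, ← Finset.sum_add_distrib]
  exact Finset.sum_le_sum fun j _ => norm_sub_le (WithLp.toLp 2 (w j)) (WithLp.toLp 2 (v j))

/-- Centring a row subtracts at most `‖w‖_{2,1} / √k` from each entry. -/
lemma abs_row_mean_le [NeZero k] (w : Matrix (Fin n) (Fin k) ℝ) (j : Fin n) :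
    |1 / (k : ℝ) * ∑ a, w j a| ≤ norm21 w / √(k : ℝ) := by
  have hk : (0 : ℝ) < k := by exact_mod_cast NeZero.pos k
  have h1 : |∑ a, w j a| ≤ √(k : ℝ) * √(∑ a, w j a ^ 2) := by
    rw [← Real.sqrt_mul hk.le, ← Real.sqrt_sq_eq_abs]
    refine Real.sqrt_le_sqrt ?_
    simpa using sq_sum_le_card_mul_sum_sq (s := Finset.univ) (f := w j)
  have h2 := sqrt_row_le_norm21 w j
  have hs : 0 < √(k : ℝ) := Real.sqrt_pos.mpr hk
  rw [abs_mul, abs_of_pos (by positivity), le_div_iff₀ hs, one_div, mul_assoc,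
    inv_mul_le_iff₀ hk]
  calc |∑ a, w j a| * √(k : ℝ) ≤ (√(k : ℝ) * norm21 w) * √(k : ℝ) := by
        gcongr
        exact h1.trans (by gcongr)
    _ = k * norm21 w := by rw [mul_right_comm, Real.mul_self_sqrt hk.le]

/-! ### The distribution of the samples -/

lemma Model.dist_toMeasure_singleton [NeZero k] (M : Model n k) (z : Fin n → Fin k) :
    M.dist.toMeasure {z} = ENNReal.ofReal (M.weight z) := by
  rw [PMF.toMeasure_apply_singleton _ _ (measurableSet_singleton z)]
  unfold Model.dist Model.weight
  rw [PMF.normalize_apply, tsum_fintype, ← ENNReal.ofReal_sum_of_nonneg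
    (fun _ _ => (Real.exp_pos _).le), div_eq_mul_inv,
    ENNReal.ofReal_mul (Real.exp_pos _).le, ENNReal.ofReal_inv_of_pos M.sum_exp_pos]

lemma Model.pi_dist_apply [NeZero k] (M : Model n k) (N : ℕ)
    (A : Set (Fin N → Fin n → Fin k)) :
    (Measure.pi fun _ : Fin N => M.dist.toMeasure) A
      = ENNReal.ofReal (iidProb M.weight N A) := by
  classical
  have hs : ∀ z : Fin N → Fin n → Fin k,
      (Measure.pi fun _ : Fin N => M.dist.toMeasure) {z}
        = ENNReal.ofReal (∏ t, M.weight (z t)) := fun z => by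
    rw [Measure.pi_singleton, ENNReal.ofReal_prod_of_nonneg fun _ _ => (M.weight_pos _).le]
    exact Finset.prod_congr rfl fun t _ => M.dist_toMeasure_singleton _
  have hA : A = ((Finset.univ.filter fun z => z ∈ A : Finset _) : Set _) := by ext; simp
  conv_lhs => rw [hA]
  rw [← sum_measure_singleton]
  unfold iidProb
  rw [Finset.sum_filter, ENNReal.ofReal_sum_of_nonneg]
  · refine Finset.sum_congr rfl fun z _ => ?_
    by_cases h : z ∈ A <;> simp [h, hs]
  · intro z _
    split_ifs
    · exact Finset.prod_nonneg fun _ _ => (M.weight_pos _).le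
    · exact le_rfl

end

/-! ### The logistic loss -/

/-- A lower bound for the logistic loss by an affine function with an arbitrary slope `-q`. The
error is the chi-squared distance of `q` from the slope at `v`. -/
lemma log_one_add_exp_sub_ge {u v q p : ℝ} (hp : p = 1 / (1 + Real.exp v)) (h0 : 0 < q)
    (h1 : q < 1) :
    -(q * (u - v)) - (q - p) ^ 2 / (p * (1 - p))
      ≤ Real.log (1 + Real.exp (-u)) - Real.log (1 + Real.exp (-v)) := by
  have hev := Real.exp_pos v
  have hp0 : 0 < p := by rw [hp]; positivity
  have hp1 : 1 - p = Real.exp v / (1 + Real.exp v) := by rw [hp]; field_simp; ring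
  have hp1' : 0 < 1 - p := by rw [hp1]; positivity
  have hq1 : 0 < 1 - q := sub_pos.mpr h1
  have hratio : Real.log (1 + Real.exp (-u)) - Real.log (1 + Real.exp (-v))
      = Real.log (p * Real.exp (-(u - v)) + (1 - p)) := by
    rw [← Real.log_div (by positivity) (by positivity)]
    congr 1
    rw [hp1, hp, neg_sub, Real.exp_sub, Real.exp_neg, Real.exp_neg]
    field_simp
    ring
  -- Jensen with weights `q` and `1 - q` gives the slope `-q` and an error equal to the relative
  -- entropy of `q` with respect to `p`.
  have hconc := strictConcaveOn_log_Ioi.concaveOn.2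
    (x := p * Real.exp (-(u - v)) / q) (y := (1 - p) / (1 - q))
    (Set.mem_Ioi.mpr (by positivity)) (Set.mem_Ioi.mpr (by positivity)) h0.le hq1.le (by ring)
  simp only [smul_eq_mul] at hconc
  rw [mul_div_cancel₀ _ h0.ne', mul_div_cancel₀ _ hq1.ne'] at hconc
  have hl1 : Real.log (p * Real.exp (-(u - v)) / q) = Real.log (p / q) - (u - v) := by
    rw [mul_div_right_comm, Real.log_mul (by positivity) (Real.exp_pos _).ne', Real.log_exp]
    ring
  -- `log x ≥ 1 - 1/x` replaces the relative entropy by the chi-squared distance.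
  have hl2 := Real.one_sub_inv_le_log_of_pos (div_pos hp0 h0)
  have hl3 := Real.one_sub_inv_le_log_of_pos (div_pos hp1' hq1)
  rw [inv_div] at hl2 hl3
  rw [hratio]
  refine le_trans ?_ hconc
  rw [hl1]
  have hchi : -((q - p) ^ 2 / (p * (1 - p)))
      = q * (1 - q / p) + (1 - q) * (1 - (1 - q) / (1 - p)) := by
    field_simp
    ring
  have := mul_le_mul_of_nonneg_left hl2 h0.le
  have := mul_le_mul_of_nonneg_left hl3 hq1.le
  linarith [mul_sub q (Real.log (p / q)) (u - v)]

/-! ### Sums over words -/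

section Words

variable {n k : ℕ}

/-- Exchanging the letter `z j` with the extra letter `a` is an involution on pairs `(z, a)`. This
is the device by which a letter is resampled below. -/
lemma sum_sum_update (j : Fin n) (F : (Fin n → Fin k) → ℝ) :
    ∑ z, ∑ a, F (Function.update z j a) = k * ∑ z, F z := by
  let e : ((Fin n → Fin k) × Fin k) ≃ ((Fin n → Fin k) × Fin k) :=
    Function.Involutive.toPerm (fun p => (Function.update p.1 j p.2, p.1 j)) (fun p => by simp)
  calc ∑ z, ∑ a, F (Function.update z j a)
      = ∑ p : (Fin n → Fin k) × Fin k, F (e p).1 := by rw [Fintype.sum_prod_type]; rfl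
    _ = ∑ p : (Fin n → Fin k) × Fin k, F p.1 := e.sum_comp (fun p => F p.1)
    _ = k * ∑ z, F z := by simp [Fintype.sum_prod_type, Finset.mul_sum]

/-- Resampling letter `i` groups the selected words into pairs that differ only in their label. -/
lemma sum_selected [NeZero k] (i : Fin n) {α β : Fin k} (h : α ≠ β)
    (F : (Fin n → Fin k) → ℝ) :
    (∑ z, if z i = α ∨ z i = β then F z else 0)
      = (1 / (k : ℝ)) * ∑ z, (F (Function.update z i α) + F (Function.update z i β)) := by
  have hk : (k : ℝ) ≠ 0 := by exact_mod_cast NeZero.ne k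
  have h1 := sum_sum_update i (fun z : Fin n → Fin k => if z i = α ∨ z i = β then F z else 0)
  rw [eq_comm, one_div, inv_mul_eq_iff_eq_mul₀ hk, ← h1]
  refine Finset.sum_congr rfl fun z _ => ?_
  rw [← Finset.sum_pair (f := fun a => F (Function.update z i a)) h, ← Finset.sum_filter]
  simp only [Function.update_self]
  refine Finset.sum_congr ?_ fun _ _ => rfl
  ext a; simp

lemma dot_eq_sum_inner (D : Matrix (Fin n) (Fin k) ℝ) [NeZero k] (i : Fin n)
    (z : Fin n → Fin k) :
    dot D (covariate i z) = ∑ l, inner ℝ (WithLp.toLp 2 (D l))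
      (EuclideanSpace.single (Function.update z i 0 l) (1 : ℝ)) := by
  rw [dot_covariate]
  refine Finset.sum_congr rfl fun l _ => ?_
  rw [EuclideanSpace.inner_single_right]
  simp

lemma covariate_update_self [NeZero k] (i : Fin n) (z : Fin n → Fin k) (a : Fin k) :
    covariate i (Function.update z i a) = covariate i z := by
  simp [covariate]

/-- The average of `c x` over the samples deviates from its mean by no more than the vectors of
its rows do. -/
lemma abs_sum_dot_sub_le [NeZero k] (μ : (Fin n → Fin k) → ℝ) (c : (Fin n → Fin k) → ℝ)
    (i : Fin n) (D : Matrix (Fin n) (Fin k) ℝ) {N : ℕ} (z : Fin N → Fin n → Fin k) {d : ℝ}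
    (hd : ∀ l, ‖∑ t, (c (z t) • EuclideanSpace.single (Function.update (z t) i 0 l) (1 : ℝ)
      - ∑ ω, μ ω • c ω • EuclideanSpace.single (Function.update ω i 0 l) (1 : ℝ))‖ ≤ d) :
    |∑ t, c (z t) * dot D (covariate i (z t)) - N * ∑ ω, μ ω * (c ω * dot D (covariate i ω))|
      ≤ norm21 D * d := by
  have h : ∑ t, c (z t) * dot D (covariate i (z t))
      - N * ∑ ω, μ ω * (c ω * dot D (covariate i ω))
      = ∑ l, inner ℝ (WithLp.toLp 2 (D l))
        (∑ t, (c (z t) • EuclideanSpace.single (Function.update (z t) i 0 l) (1 : ℝ)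
          - ∑ ω, μ ω • c ω • EuclideanSpace.single (Function.update ω i 0 l) (1 : ℝ))) := by
    have h1 : ∑ t, c (z t) * dot D (covariate i (z t))
        = ∑ l, inner ℝ (WithLp.toLp 2 (D l))
          (∑ t, c (z t) • EuclideanSpace.single (Function.update (z t) i 0 l) (1 : ℝ)) := by
      simp_rw [inner_sum, real_inner_smul_right, dot_eq_sum_inner, Finset.mul_sum]
      exact Finset.sum_comm
    have h2 : ∑ ω, μ ω * (c ω * dot D (covariate i ω))
        = ∑ l, inner ℝ (WithLp.toLp 2 (D l))
          (∑ ω, μ ω • c ω • EuclideanSpace.single (Function.update ω i 0 l) (1 : ℝ)) := by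
      simp_rw [inner_sum, real_inner_smul_right, dot_eq_sum_inner, Finset.mul_sum]
      exact Finset.sum_comm
    rw [h1, h2, Finset.mul_sum, ← Finset.sum_sub_distrib]
    refine Finset.sum_congr rfl fun l _ => ?_
    rw [Finset.sum_sub_distrib, inner_sub_right, Finset.sum_const, Finset.card_univ,
      Fintype.card_fin, ← Nat.cast_smul_eq_nsmul ℝ, real_inner_smul_right]
  rw [h, norm21_eq_sum_norm, Finset.sum_mul]
  refine (Finset.abs_sum_le_sum_abs _ _).trans (Finset.sum_le_sum fun l _ => ?_)
  -- Cauchy–Schwarz within each row: the (2,1)-norm is dual to the largest row norm, so a bound on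
  -- each row suffices.
  exact (abs_real_inner_le_norm _ _).trans (mul_le_mul_of_nonneg_left (hd l) (norm_nonneg _))

end Words

/-! ### The dual certificate of a regression -/

/-- `a b / (a + b) = (a⁻¹ + b⁻¹)⁻¹` is increasing and homogeneous of degree one. -/
lemma harmonic_le {a b c d e : ℝ} (ha : 0 < a) (hb : 0 < b) (hc : 0 < c) (hd : 0 < d)
    (h1 : a ≤ e * c) (h2 : b ≤ e * d) : a * b / (a + b) ≤ e * (c * d / (c + d)) := by
  have he : 0 < e := pos_of_mul_pos_left (ha.trans_le h1) hc.le
  have hinv : ∀ x y : ℝ, 0 < x → 0 < y → x * y / (x + y) = (x⁻¹ + y⁻¹)⁻¹ := fun x y hx hy => by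
    field_simp
    ring
  calc a * b / (a + b) = (a⁻¹ + b⁻¹)⁻¹ := hinv a b ha hb
    _ ≤ ((e * c)⁻¹ + (e * d)⁻¹)⁻¹ := by gcongr
    _ = e * (c * d / (c + d)) := by
        rw [← hinv _ _ (by positivity) (by positivity)]
        field_simp

namespace Model

variable {n k : ℕ} [NeZero k] (M : Model n k)

/-- The probability that variable `i` is `α` or `β` while the others agree with `z`. -/
def pairMass (i : Fin n) (α β : Fin k) (z : Fin n → Fin k) : ℝ :=
  M.weight (Function.update z i α) + M.weight (Function.update z i β)

/-- Half the harmonic mean of the probabilities of `z` with variable `i` set to `α` and to `β`. -/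
def harm (i : Fin n) (α β : Fin k) (z : Fin n → Fin k) : ℝ :=
  M.weight (Function.update z i α) * M.weight (Function.update z i β) / M.pairMass i α β z

/-- The total of `harm` over the selected words. -/
def harmTotal (i : Fin n) (α β : Fin k) : ℝ :=
  ∑ z, if z i = α ∨ z i = β then M.harm i α β z else 0

/-- The perturbation of the residuals that detects the entry `(j, b)`. -/
def tilt (lam τ : ℝ) (i : Fin n) (α β : Fin k) (j : Fin n) (b : Fin k) (z : Fin n → Fin k) : ℝ :=
  -- The first factor sums to zero over the letters at `j`. In the second, the sum of `harm` does
  -- not depend on `z j`, and its prefactor makes it at most `harm` itself, so the tilt is at most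
  -- `τ` times the logistic variance `harm / pairMass`.
  τ * ((if z j = b then 1 else 0) - 1 / (k : ℝ))
    * ((Real.exp (2 * lam) * k)⁻¹ * (∑ a, M.harm i α β (Function.update z j a))
      / M.pairMass i α β z)

/-- The perturbed signed residual of a sample. -/
def certWeight (lam τ : ℝ) (i : Fin n) (α β : Fin k) (j : Fin n) (b : Fin k)
    (z : Fin n → Fin k) : ℝ :=
  if z i = α ∨ z i = β then
    -- `harm / weight` is the conditional probability of the label not observed. Multiplied by
    -- `weight` it takes the same value for both labels, so the untilted residuals cancel in mean.
    M.harm i α β z / M.weight z * label i α z - M.tilt lam τ i α β j b z else 0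

/-- The chi-squared cost of the perturbation. -/
def certCost (lam τ : ℝ) (i : Fin n) (α β : Fin k) (j : Fin n) (b : Fin k)
    (z : Fin n → Fin k) : ℝ :=
  if z i = α ∨ z i = β then
    M.tilt lam τ i α β j b z ^ 2 * (M.pairMass i α β z / M.harm i α β z) else 0

variable {i : Fin n} {α β : Fin k}

lemma pairMass_pos (z : Fin n → Fin k) : 0 < M.pairMass i α β z :=
  add_pos (M.weight_pos _) (M.weight_pos _)

lemma harm_pos (z : Fin n → Fin k) : 0 < M.harm i α β z :=
  div_pos (mul_pos (M.weight_pos _) (M.weight_pos _)) (M.pairMass_pos z)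

omit [NeZero k] in
lemma pairMass_update (z : Fin n → Fin k) (a : Fin k) :
    M.pairMass i α β (Function.update z i a) = M.pairMass i α β z := by
  simp [pairMass]

omit [NeZero k] in
lemma harm_update (z : Fin n → Fin k) (a : Fin k) :
    M.harm i α β (Function.update z i a) = M.harm i α β z := by
  simp [harm, pairMass_update]

omit [NeZero k] in
lemma tilt_update {j : Fin n} (hij : j ≠ i) (lam τ : ℝ) (b : Fin k) (z : Fin n → Fin k)
    (a : Fin k) :
    M.tilt lam τ i α β j b (Function.update z i a) = M.tilt lam τ i α β j b z := by
  simp only [tilt, pairMass_update, Function.update_of_ne hij]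
  have h : ∀ c, M.harm i α β (Function.update (Function.update z i a) j c)
      = M.harm i α β (Function.update z j c) := fun c => by
    rw [Function.update_comm hij.symm, harm_update]
  simp_rw [h]

lemma harm_update_le {lam : ℝ} (hM : M.width ≤ lam) {j : Fin n} (hij : j ≠ i)
    (z : Fin n → Fin k) (a : Fin k) :
    M.harm i α β (Function.update z j a) ≤ Real.exp (2 * lam) * M.harm i α β z := by
  unfold harm pairMass
  rw [Function.update_comm hij, Function.update_comm hij]
  exact harmonic_le (M.weight_pos _) (M.weight_pos _) (M.weight_pos _) (M.weight_pos _)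
    (M.weight_update_le hM _ _ _) (M.weight_update_le hM _ _ _)

lemma sum_harm_update_le {lam : ℝ} (hM : M.width ≤ lam) {j : Fin n} (hij : j ≠ i)
    (z : Fin n → Fin k) :
    (Real.exp (2 * lam) * k)⁻¹ * ∑ a, M.harm i α β (Function.update z j a)
      ≤ M.harm i α β z := by
  have hk : (0 : ℝ) < k := by exact_mod_cast NeZero.pos k
  rw [inv_mul_le_iff₀ (mul_pos (Real.exp_pos _) hk)]
  calc _ ≤ ∑ _a : Fin k, Real.exp (2 * lam) * M.harm i α β z :=
        Finset.sum_le_sum fun a _ => M.harm_update_le hM hij z a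
    _ = _ := by simp; ring

lemma sum_harm_nonneg (j : Fin n) (z : Fin n → Fin k) :
    0 ≤ ∑ a, M.harm i α β (Function.update z j a) :=
  Finset.sum_nonneg fun _ _ => (M.harm_pos _).le

lemma abs_ind_sub_le (p : Prop) [Decidable p] :
    |(if p then (1 : ℝ) else 0) - 1 / (k : ℝ)| ≤ 1 := by
  have hk : (1 : ℝ) ≤ k := by exact_mod_cast NeZero.one_le
  have h1 : 1 / (k : ℝ) ≤ 1 := by rw [div_le_one (by linarith)]; exact hk
  have h2 : 0 ≤ 1 / (k : ℝ) := by positivity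
  rw [abs_le]
  split_ifs <;> constructor <;> linarith

lemma abs_tilt_le {lam τ : ℝ} (hM : M.width ≤ lam) (hτ : 0 ≤ τ) {j : Fin n} (hij : j ≠ i)
    (b : Fin k) (z : Fin n → Fin k) :
    |M.tilt lam τ i α β j b z| ≤ τ * (M.harm i α β z / M.pairMass i α β z) := by
  have hk : (0 : ℝ) < k := by exact_mod_cast NeZero.pos k
  have hA := M.pairMass_pos (i := i) (α := α) (β := β) z
  have hS := M.sum_harm_nonneg (i := i) (α := α) (β := β) j z
  have hX : 0 ≤ (Real.exp (2 * lam) * k)⁻¹ * (∑ a, M.harm i α β (Function.update z j a))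
      / M.pairMass i α β z :=
    div_nonneg (mul_nonneg (inv_nonneg.mpr (mul_pos (Real.exp_pos _) hk).le) hS) hA.le
  unfold tilt
  rw [abs_mul, abs_mul, abs_of_nonneg hτ, abs_of_nonneg hX]
  have h1 := abs_ind_sub_le (k := k) (z j = b)
  have h2 := M.sum_harm_update_le (α := α) (β := β) hM hij z
  calc _ ≤ τ * 1 * (M.harm i α β z / M.pairMass i α β z) :=
        mul_le_mul (mul_le_mul_of_nonneg_left h1 hτ) (div_le_div_of_nonneg_right h2 hA.le) hX
          (mul_nonneg hτ zero_le_one)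
    _ = _ := by rw [mul_one]

/-- The data of the logistic regression at a selected word. -/
lemma harm_div_weight {z : Fin n → Fin k} (hz : z i = α ∨ z i = β) :
    M.harm i α β z / M.weight z
        = 1 / (1 + Real.exp (label i α z * dot (M.trueParam i α β) (covariate i z)))
      ∧ M.harm i α β z / M.weight z * (1 - M.harm i α β z / M.weight z)
        = M.harm i α β z / M.pairMass i α β z
      ∧ 0 < M.harm i α β z / M.weight z ∧ M.harm i α β z / M.weight z < 1 := by
  have hexp := M.weight_update_eq_exp_dot i α β z
  have hα := M.weight_pos (Function.update z i α)
  have hβ := M.weight_pos (Function.update z i β)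
  set A := M.weight (Function.update z i α) with hA
  set B := M.weight (Function.update z i β) with hB
  -- Covers both labels at once: `X` is the probability of the observed word and `Y` that of the
  -- word with the other label, so the quotient is `Y / (X + Y)`.
  have key : ∀ s X Y : ℝ, 0 < X → 0 < Y → X * Y = A * B → X + Y = A + B → X = Real.exp s * Y →
      A * B / (A + B) / X = 1 / (1 + Real.exp s) ∧
      A * B / (A + B) / X * (1 - A * B / (A + B) / X) = A * B / (A + B) / (A + B) ∧
      0 < A * B / (A + B) / X ∧ A * B / (A + B) / X < 1 := by
    intro s X Y hX hY h1 h2 h3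
    have h4 : A * B / (A + B) / X = Y / (X + Y) := by rw [← h1, ← h2]; field_simp
    refine ⟨?_, ?_, by rw [h4]; positivity, ?_⟩
    · rw [h4, h3]; field_simp; ring
    · rw [h4, ← h1, ← h2]; field_simp; ring
    · rw [h4, div_lt_one (by positivity)]; linarith
  unfold harm pairMass label
  by_cases h : z i = α
  · have hw : M.weight z = A := by rw [hA, ← h, Function.update_eq_self]
    rw [hw, if_pos h, one_mul]
    exact key _ A B hα hβ rfl rfl hexp
  · have hzβ : z i = β := hz.resolve_left h
    have hw : M.weight z = B := by rw [hB, ← hzβ, Function.update_eq_self]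
    rw [hw, if_neg h]
    refine key _ B A hβ hα (mul_comm _ _) (add_comm _ _) ?_
    rw [hexp, neg_one_mul, Real.exp_neg, inv_mul_cancel_left₀ (Real.exp_pos _).ne']

/-- A lower bound for the excess loss at one sample. -/
lemma loss_sub_ge {lam τ : ℝ} (hM : M.width ≤ lam) (hτ : 0 ≤ τ) (hτ1 : τ < 1) {j : Fin n}
    (hij : j ≠ i) (b : Fin k) {z : Fin n → Fin k} (hz : z i = α ∨ z i = β)
    (w : Matrix (Fin n) (Fin k) ℝ) :
    -(M.certWeight lam τ i α β j b z * dot (w - M.trueParam i α β) (covariate i z))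
        - M.certCost lam τ i α β j b z
      ≤ Real.log (1 + Real.exp (-(label i α z * dot w (covariate i z))))
        - Real.log (1 + Real.exp (-(label i α z
          * dot (M.trueParam i α β) (covariate i z)))) := by
  obtain ⟨h1, h2, h3, h4⟩ := M.harm_div_weight hz
  have ht := M.abs_tilt_le (α := α) (β := β) hM hτ hij b z
  have hcost : M.certCost lam τ i α β j b z = (M.tilt lam τ i α β j b z) ^ 2
      / (M.harm i α β z / M.weight z * (1 - M.harm i α β z / M.weight z)) := by
    rw [h2, certCost, if_pos hz, div_div_eq_mul_div, mul_div_assoc]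
  rw [← h2] at ht
  rw [hcost]
  unfold certWeight
  rw [if_pos hz]
  set p := M.harm i α β z / M.weight z with hp
  set r := M.tilt lam τ i α β j b z with hr
  set y := label i α z with hy
  have hyy : y * y = 1 := by
    rw [hy]; unfold label; split_ifs <;> norm_num
  have hyr : |y * r| ≤ τ * (p * (1 - p)) := by
    have : |y| = 1 := by rw [hy]; unfold label; split_ifs <;> norm_num
    rw [abs_mul, this, one_mul]; exact ht
  have hpp : 0 < p * (1 - p) := mul_pos h3 (sub_pos.mpr h4)
  have hlt : τ * (p * (1 - p)) < p * (1 - p) := by nlinarith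
  obtain ⟨ha, hb⟩ := abs_le.mp hyr
  -- The tilted slope `p - y r` stays in `(0, 1)` since `|r| ≤ τ p (1 - p)`. Multiplied by the label
  -- it becomes `p y - r`, the certificate weight.
  have h5 := log_one_add_exp_sub_ge (u := y * dot w (covariate i z)) (q := p - y * r) h1
    (by nlinarith) (by nlinarith)
  refine le_trans (le_of_eq ?_) h5
  have hd : dot (w - M.trueParam i α β) (covariate i z)
      = dot w (covariate i z) - dot (M.trueParam i α β) (covariate i z) := by
    simp [dot, sub_mul, Finset.sum_sub_distrib]
  have hsq : (p - y * r - p) ^ 2 = r ^ 2 := by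
    have : (p - y * r - p) ^ 2 = (y * y) * r ^ 2 := by ring
    rw [this, hyy, one_mul]
  rw [hsq, hd]
  linear_combination (-r * (dot w (covariate i z)
    - dot (M.trueParam i α β) (covariate i z))) * hyy

/-! ### Mean, cost and variance of the certificate -/

lemma harmTotal_eq (h : α ≠ β) :
    M.harmTotal i α β = 2 / (k : ℝ) * ∑ z, M.harm i α β z := by
  rw [harmTotal, sum_selected i h]
  simp_rw [harm_update, ← two_mul, ← Finset.mul_sum]
  ring

/-- Setting letter `i` to `α` or `β` costs at most a factor `exp (2 * lam)`, hence `harm ≥ weight /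
(2 exp (2 * lam))` pointwise, and the weights sum to one. -/
lemma harmTotal_ge {lam : ℝ} (hM : M.width ≤ lam) (h : α ≠ β) :
    (Real.exp (2 * lam) * k)⁻¹ ≤ M.harmTotal i α β := by
  have hk : (0 : ℝ) < k := by exact_mod_cast NeZero.pos k
  have he := Real.exp_pos (2 * lam)
  have h1 : ∀ z, M.weight z ≤ 2 * Real.exp (2 * lam) * M.harm i α β z := fun z => by
    have hup : ∀ a, M.weight z ≤ Real.exp (2 * lam) * M.weight (Function.update z i a) :=
      fun a => by
        have := M.weight_update_le hM i (Function.update z i a) (z i)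
        simpa using this
    have := harmonic_le (M.weight_pos z) (M.weight_pos z) (M.weight_pos _) (M.weight_pos _)
      (hup α) (hup β)
    have hz := M.weight_pos z
    have h2 : M.weight z * M.weight z / (M.weight z + M.weight z) = M.weight z / 2 := by
      field_simp; ring
    rw [h2] at this
    unfold harm pairMass
    linarith
  have h2 : 1 ≤ 2 * Real.exp (2 * lam) * ∑ z, M.harm i α β z := by
    rw [← M.sum_weight, Finset.mul_sum]
    exact Finset.sum_le_sum fun z _ => h1 z
  rw [M.harmTotal_eq h, inv_le_iff_one_le_mul₀ (by positivity)]
  calc 1 ≤ 2 * Real.exp (2 * lam) * ∑ z, M.harm i α β z := h2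
    _ = _ := by field_simp

omit [NeZero k] in
lemma sum_ite_sub_mul (b : Fin k) (g : Fin k → ℝ) :
    ∑ a, ((if a = b then (1 : ℝ) else 0) - 1 / (k : ℝ)) * g a
      = g b - 1 / (k : ℝ) * ∑ a, g a := by
  simp [sub_mul, Finset.sum_sub_distrib, Finset.mul_sum]

/-- Only row `j` of the prediction depends on `a`; the other rows are killed because the
coefficients sum to zero. -/
lemma sum_ite_sub_dot_update {j : Fin n} (hij : j ≠ i) (b : Fin k)
    (D : Matrix (Fin n) (Fin k) ℝ) (z : Fin n → Fin k) :
    ∑ a, ((if a = b then (1 : ℝ) else 0) - 1 / (k : ℝ))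
        * dot D (covariate i (Function.update z j a)) = center i D j b := by
  have hk : (k : ℝ) ≠ 0 := by exact_mod_cast NeZero.ne k
  have h : ∀ a, dot D (covariate i (Function.update z j a))
      = D j a + ∑ l ∈ Finset.univ.erase j, D l (Function.update z i 0 l) := fun a => by
    rw [dot_covariate, ← Finset.add_sum_erase _ _ (Finset.mem_univ j),
      Function.update_comm hij]
    congr 1
    · simp
    · exact Finset.sum_congr rfl fun l hl => by
        rw [Function.update_of_ne (Finset.ne_of_mem_erase hl)]
  rw [sum_ite_sub_mul]
  simp_rw [h, Finset.sum_add_distrib]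
  simp only [center, hij, if_false, Finset.sum_const, Finset.card_univ, Fintype.card_fin,
    nsmul_eq_mul]
  field_simp
  ring

/-- The mean of the certificate picks out one centred entry. -/
lemma sum_certWeight_mul_dot (h : α ≠ β) {j : Fin n} (hij : j ≠ i) (lam τ : ℝ) (b : Fin k)
    (D : Matrix (Fin n) (Fin k) ℝ) :
    ∑ z, M.weight z * (M.certWeight lam τ i α β j b z * dot D (covariate i z))
      = -(τ * (Real.exp (2 * lam) * k)⁻¹ * M.harmTotal i α β / 2 * center i D j b) := by
  have hk : (k : ℝ) ≠ 0 := by exact_mod_cast NeZero.ne k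
  set δ := (Real.exp (2 * lam) * k)⁻¹ with hδ
  have h1 : ∑ z, M.weight z * (M.certWeight lam τ i α β j b z * dot D (covariate i z))
      = ∑ z, if z i = α ∨ z i = β then (M.harm i α β z * label i α z
        - M.weight z * M.tilt lam τ i α β j b z) * dot D (covariate i z) else 0 := by
    refine Finset.sum_congr rfl fun z _ => ?_
    unfold certWeight
    have := (M.weight_pos z).ne'
    split_ifs
    · field_simp
    · simp
  -- For a pair of words differing in the label, the residual terms `harm * label` cancel and only
  -- the tilt remains. The factor `pairMass` then clears its denominator.
  have h2 : ∀ z : Fin n → Fin k,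
      (M.harm i α β (Function.update z i α) * label i α (Function.update z i α)
        - M.weight (Function.update z i α)
          * M.tilt lam τ i α β j b (Function.update z i α))
            * dot D (covariate i (Function.update z i α))
      + (M.harm i α β (Function.update z i β) * label i α (Function.update z i β)
        - M.weight (Function.update z i β)
          * M.tilt lam τ i α β j b (Function.update z i β))
            * dot D (covariate i (Function.update z i β))
      = -(τ * δ) * (((if z j = b then 1 else 0) - 1 / (k : ℝ))
          * (∑ a, M.harm i α β (Function.update z j a)) * dot D (covariate i z)) := by
    intro z
    simp only [harm_update, M.tilt_update hij, covariate_update_self, label,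
      Function.update_self, if_true, h.symm, if_false]
    have hA := (M.pairMass_pos (i := i) (α := α) (β := β) z).ne'
    have h3 : M.pairMass i α β z * M.tilt lam τ i α β j b z
        = τ * δ * (((if z j = b then 1 else 0) - 1 / (k : ℝ))
          * (∑ a, M.harm i α β (Function.update z j a))) := by
      unfold tilt
      rw [hδ]
      field_simp
    unfold pairMass at h3
    linear_combination (-(dot D (covariate i z))) * h3
  -- Resample letter `j`: the sum of `harm` is constant in that letter, so the inner sum isolates
  -- the centred entry.
  have h4 := sum_sum_update j (fun z => ((if z j = b then 1 else 0) - 1 / (k : ℝ))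
    * (∑ a, M.harm i α β (Function.update z j a)) * dot D (covariate i z))
  simp only [Function.update_self, Function.update_idem] at h4
  have h5 : ∀ z : Fin n → Fin k, ∑ a, ((if a = b then 1 else 0) - 1 / (k : ℝ))
      * (∑ a, M.harm i α β (Function.update z j a))
        * dot D (covariate i (Function.update z j a))
      = (∑ a, M.harm i α β (Function.update z j a)) * center i D j b := fun z => by
    rw [← sum_ite_sub_dot_update hij b D z, Finset.mul_sum]
    exact Finset.sum_congr rfl fun a _ => by ring
  simp_rw [h5] at h4
  rw [← Finset.sum_mul, sum_sum_update] at h4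
  rw [h1, sum_selected i h, Finset.sum_congr rfl fun z _ => h2 z, ← Finset.mul_sum,
    M.harmTotal_eq h]
  have h6 := mul_left_cancel₀ hk ((mul_assoc _ _ _).symm.trans h4)
  rw [← h6]
  field_simp

/-- One factor of the squared tilt is absorbed by `sum_harm_update_le`, and the squared indicator
deviations sum to `1 - 1/k ≤ 1`. The result is `τ²` times the factor that multiplies `τ` in the mean
of the certificate, so a small `τ` makes the cost harmless. -/
lemma sum_certCost_le {lam τ : ℝ} (hM : M.width ≤ lam) (h : α ≠ β) {j : Fin n} (hij : j ≠ i)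
    (b : Fin k) :
    ∑ z, M.weight z * M.certCost lam τ i α β j b z
      ≤ τ ^ 2 * ((Real.exp (2 * lam) * k)⁻¹ * M.harmTotal i α β / 2) := by
  have hk : (0 : ℝ) < k := by exact_mod_cast NeZero.pos k
  set δ := (Real.exp (2 * lam) * k)⁻¹ with hδ
  have hδ0 : 0 < δ := by positivity
  have h1 : ∑ z, M.weight z * M.certCost lam τ i α β j b z
      = ∑ z, if z i = α ∨ z i = β then M.weight z * (M.tilt lam τ i α β j b z ^ 2
        * (M.pairMass i α β z / M.harm i α β z)) else 0 := by
    refine Finset.sum_congr rfl fun z _ => ?_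
    unfold certCost
    split_ifs <;> simp
  have h2 : ∀ z : Fin n → Fin k,
      M.weight (Function.update z i α) * (M.tilt lam τ i α β j b (Function.update z i α) ^ 2
        * (M.pairMass i α β (Function.update z i α) / M.harm i α β (Function.update z i α)))
      + M.weight (Function.update z i β) * (M.tilt lam τ i α β j b (Function.update z i β) ^ 2
        * (M.pairMass i α β (Function.update z i β) / M.harm i α β (Function.update z i β)))
      ≤ τ ^ 2 * δ * (((if z j = b then 1 else 0) - 1 / (k : ℝ)) ^ 2
          * ∑ a, M.harm i α β (Function.update z j a)) := by
    intro z
    simp only [harm_update, M.tilt_update hij, pairMass_update]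
    have hA := M.pairMass_pos (i := i) (α := α) (β := β) z
    have hH := M.harm_pos (i := i) (α := α) (β := β) z
    have hS := M.sum_harm_nonneg (i := i) (α := α) (β := β) j z
    have h3 : M.weight (Function.update z i α) * (M.tilt lam τ i α β j b z ^ 2
        * (M.pairMass i α β z / M.harm i α β z))
      + M.weight (Function.update z i β) * (M.tilt lam τ i α β j b z ^ 2
        * (M.pairMass i α β z / M.harm i α β z))
      = τ ^ 2 * δ * (((if z j = b then 1 else 0) - 1 / (k : ℝ)) ^ 2
          * ∑ a, M.harm i α β (Function.update z j a))
        * (δ * (∑ a, M.harm i α β (Function.update z j a)) / M.harm i α β z) := by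
      rw [← add_mul]
      change M.pairMass i α β z * _ = _
      unfold tilt
      rw [← hδ]
      field_simp
    rw [h3]
    refine mul_le_of_le_one_right (mul_nonneg (mul_nonneg (sq_nonneg _) hδ0.le)
      (mul_nonneg (sq_nonneg _) hS)) ?_
    rw [div_le_one hH]
    exact M.sum_harm_update_le hM hij z
  have h4 := sum_sum_update j (fun z => ((if z j = b then 1 else 0) - 1 / (k : ℝ)) ^ 2
    * ∑ a, M.harm i α β (Function.update z j a))
  simp only [Function.update_self, Function.update_idem] at h4
  have hone : ∑ a : Fin k, ((if a = b then 1 else 0) - 1 / (k : ℝ)) ^ 2 ≤ 1 := by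
    have h5 : ∀ a : Fin k, ((if a = b then (1 : ℝ) else 0) - 1 / (k : ℝ)) ^ 2
        = ((if a = b then 1 else 0) - 1 / (k : ℝ))
          * ((if a = b then 1 else 0) - 1 / (k : ℝ)) := fun a => sq _
    simp_rw [h5, sum_ite_sub_mul]
    simp [Finset.sum_sub_distrib, hk.ne']
  have h6 : k * ∑ z, (((if z j = b then 1 else 0) - 1 / (k : ℝ)) ^ 2
        * ∑ a, M.harm i α β (Function.update z j a))
      ≤ k * ∑ z, M.harm i α β z := by
    rw [← h4, ← sum_sum_update j]
    refine Finset.sum_le_sum fun z _ => ?_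
    rw [← Finset.sum_mul]
    exact mul_le_of_le_one_left (M.sum_harm_nonneg j z) hone
  have h7 := le_of_mul_le_mul_left h6 hk
  rw [h1, sum_selected i h, M.harmTotal_eq h]
  calc _ ≤ 1 / (k : ℝ) * ∑ z : Fin n → Fin k, τ ^ 2 * δ
          * (((if z j = b then 1 else 0) - 1 / (k : ℝ)) ^ 2
            * ∑ a, M.harm i α β (Function.update z j a)) := by
        gcongr with z; exact h2 z
    _ ≤ 1 / (k : ℝ) * (τ ^ 2 * δ * ∑ z, M.harm i α β z) := by
        rw [← Finset.mul_sum]; gcongr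
    _ = _ := by ring

lemma certCost_nonneg (lam τ : ℝ) (j : Fin n) (b : Fin k) (z : Fin n → Fin k) :
    0 ≤ M.certCost lam τ i α β j b z := by
  unfold certCost
  split_ifs
  · exact mul_nonneg (sq_nonneg _) (div_pos (M.pairMass_pos z) (M.harm_pos z)).le
  · exact le_rfl

lemma certCost_le {lam τ : ℝ} (hM : M.width ≤ lam) (hτ : 0 ≤ τ) {j : Fin n} (hij : j ≠ i)
    (b : Fin k) (z : Fin n → Fin k) : M.certCost lam τ i α β j b z ≤ τ ^ 2 := by
  unfold certCost
  split_ifs with hz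
  · obtain ⟨-, h2, h3, h4⟩ := M.harm_div_weight hz
    have ht := M.abs_tilt_le (α := α) (β := β) hM hτ hij b z
    have hA := M.pairMass_pos (i := i) (α := α) (β := β) z
    have hH := M.harm_pos (i := i) (α := α) (β := β) z
    have hle : M.harm i α β z / M.pairMass i α β z ≤ 1 := by rw [← h2]; nlinarith
    have h5 : M.tilt lam τ i α β j b z ^ 2
        ≤ (τ * (M.harm i α β z / M.pairMass i α β z)) ^ 2 := sq_le_sq.mpr (by
      rw [abs_of_nonneg (a := τ * _) (by positivity)]; exact ht)
    calc _ ≤ (τ * (M.harm i α β z / M.pairMass i α β z)) ^ 2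
          * (M.pairMass i α β z / M.harm i α β z) := by gcongr
      _ = τ ^ 2 * (M.harm i α β z / M.pairMass i α β z) := by field_simp
      _ ≤ τ ^ 2 := mul_le_of_le_one_right (sq_nonneg _) hle
  · exact sq_nonneg _

/-- The weight is at most `p + p (1 - p)` in absolute value, which is at most `1` and at most `2 p`;
also `weight * p = harm`. Hence the variance in Bernstein's inequality is at most `4 * harmTotal`.
-/
lemma abs_certWeight_le {lam τ : ℝ} (hM : M.width ≤ lam) (hτ : 0 ≤ τ) (hτ1 : τ < 1)
    {j : Fin n} (hij : j ≠ i) (b : Fin k) (z : Fin n → Fin k) :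
    |M.certWeight lam τ i α β j b z| ≤ 1 ∧ M.weight z * M.certWeight lam τ i α β j b z ^ 2
      ≤ if z i = α ∨ z i = β then 4 * M.harm i α β z else 0 := by
  unfold certWeight
  split_ifs with hz
  · obtain ⟨-, h2, h3, h4⟩ := M.harm_div_weight hz
    have ht := M.abs_tilt_le (α := α) (β := β) hM hτ hij b z
    rw [← h2] at ht
    have hw := M.weight_pos z
    have hwp : M.weight z * (M.harm i α β z / M.weight z) = M.harm i α β z := by field_simp
    set p := M.harm i α β z / M.weight z with hp
    have hpp : 0 < p * (1 - p) := mul_pos h3 (sub_pos.mpr h4)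
    have hy : |label i α z| = 1 := by unfold label; split_ifs <;> norm_num
    have h5 : |p * label i α z - M.tilt lam τ i α β j b z| ≤ p + p * (1 - p) := by
      refine (abs_sub _ _).trans ?_
      rw [abs_mul, hy, mul_one, abs_of_pos h3]
      nlinarith
    refine ⟨h5.trans (by nlinarith), ?_⟩
    have h6 : (p * label i α z - M.tilt lam τ i α β j b z) ^ 2 ≤ 4 * p := by
      rw [← sq_abs]
      calc _ ≤ (p + p * (1 - p)) ^ 2 := by gcongr
        _ ≤ (2 * p) ^ 2 := by gcongr; nlinarith
        _ ≤ 4 * p := by nlinarith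
    nlinarith
  · simp

end Model

section

variable {n k N : ℕ} [NeZero k]

/-! ### Constrained minimizers -/

/-- The logistic loss of one sample. -/
def sampleLoss (i : Fin n) (α : Fin k) (w : Matrix (Fin n) (Fin k) ℝ) (s : Fin n → Fin k) : ℝ :=
  Real.log (1 + Real.exp (-(label i α s * dot w (covariate i s))))

lemma IsConstrainedMinimizer.sum_le {lam : ℝ} {z : Fin N → Fin n → Fin k} {i : Fin n}
    {α β : Fin k} {w : Matrix (Fin n) (Fin k) ℝ} (hw : IsConstrainedMinimizer lam z i α β w)
    {v : Matrix (Fin n) (Fin k) ℝ} (hv : norm21 v ≤ 2 * lam * √(k : ℝ)) :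
    ∑ t ∈ selected z i α β, sampleLoss i α w (z t)
      ≤ ∑ t ∈ selected z i α β, sampleLoss i α v (z t) := by
  rcases (selected z i α β).eq_empty_or_nonempty with h | h
  · simp [h]
  · have hc : (0 : ℝ) < (selected z i α β).card := by exact_mod_cast h.card_pos
    exact le_of_mul_le_mul_left (hw.2 v hv) (one_div_pos.mpr hc)

omit [NeZero k] in
lemma label_swap {i : Fin n} {α β : Fin k} (h : α ≠ β) {s : Fin n → Fin k}
    (hs : s i = α ∨ s i = β) : label i β s = -label i α s := by
  unfold label
  rcases hs with hs | hs <;> simp [hs, h, h.symm]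

omit [NeZero k] in
lemma dot_neg (w x : Matrix (Fin n) (Fin k) ℝ) : dot (-w) x = -dot w x := by
  simp [dot]

lemma empiricalLoss_swap (z : Fin N → Fin n → Fin k) (i : Fin n) {α β : Fin k} (h : α ≠ β)
    (w : Matrix (Fin n) (Fin k) ℝ) :
    empiricalLoss z i β α (-w) = empiricalLoss z i α β w := by
  have hsel : selected z i β α = selected z i α β := by
    unfold selected; simp_rw [or_comm]
  unfold empiricalLoss
  rw [hsel]
  congr 1
  refine Finset.sum_congr rfl fun t ht => ?_
  rw [label_swap h (by simpa [selected] using ht), dot_neg, neg_mul_neg]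

/-- Exchanging `α` and `β` flips all labels, which negating `w` undoes. One-sided bounds thereby
become two-sided. -/
lemma IsConstrainedMinimizer.swap {lam : ℝ} {z : Fin N → Fin n → Fin k} {i : Fin n}
    {α β : Fin k} (h : α ≠ β) {w : Matrix (Fin n) (Fin k) ℝ}
    (hw : IsConstrainedMinimizer lam z i α β w) :
    IsConstrainedMinimizer lam z i β α (-w) := by
  refine ⟨by rw [norm21_neg]; exact hw.1, fun v hv => ?_⟩
  rw [empiricalLoss_swap z i h, ← neg_neg v, empiricalLoss_swap z i h]
  exact hw.2 _ (by rw [norm21_neg]; exact hv)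

omit [NeZero k] in
lemma continuous_norm21 : Continuous (norm21 : Matrix (Fin n) (Fin k) ℝ → ℝ) := by
  unfold norm21
  fun_prop

lemma continuous_empiricalLoss (z : Fin N → Fin n → Fin k) (i : Fin n) (α β : Fin k) :
    Continuous (empiricalLoss z i α β) := by
  unfold empiricalLoss dot
  refine continuous_const.mul (continuous_finsetSum _ fun t _ => ?_)
  exact Continuous.log (by fun_prop) fun w => (by positivity)

lemma exists_isConstrainedMinimizer {lam : ℝ} (hlam : 0 ≤ lam) (z : Fin N → Fin n → Fin k)
    (i : Fin n) (α β : Fin k) : ∃ w, IsConstrainedMinimizer lam z i α β w := by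
  set R := 2 * lam * √(k : ℝ) with hR
  have hR0 : 0 ≤ R := by positivity
  have hcpt : IsCompact {w : Matrix (Fin n) (Fin k) ℝ | norm21 w ≤ R} := by
    have hbig : IsCompact (Set.univ.pi fun _ : Fin n => Set.univ.pi fun _ : Fin k =>
        Set.Icc (-R) R) :=
      isCompact_univ_pi fun _ => isCompact_univ_pi fun _ => isCompact_Icc
    refine hbig.of_isClosed_subset (isClosed_le continuous_norm21 continuous_const) ?_
    intro w hw j _ b _
    exact abs_le.mp ((abs_le_norm21 w j b).trans hw)
  obtain ⟨w, hw, hmin⟩ := hcpt.exists_isMinOn ⟨0, by simpa [norm21] using hR0⟩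
    (continuous_empiricalLoss z i α β).continuousOn
  exact ⟨w, hw, fun v hv => hmin hv⟩

/-! ### Consequences of optimality -/

/-- If the certificate concentrates, then no centred entry of a minimizer exceeds the true one by
much. -/
lemma IsConstrainedMinimizer.center_sub_le (M : Model n k) {lam τ : ℝ} (hM : M.width ≤ lam)
    (hτ : 0 ≤ τ) (hτ1 : τ < 1) {z : Fin N → Fin n → Fin k} {i j : Fin n} (hij : j ≠ i)
    {α β : Fin k} (h : α ≠ β) (b : Fin k) {w : Matrix (Fin n) (Fin k) ℝ}
    (hw : IsConstrainedMinimizer lam z i α β w) {d P : ℝ} (hd0 : 0 ≤ d)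
    (hd : ∀ l, ‖∑ t, (M.certWeight lam τ i α β j b (z t)
        • EuclideanSpace.single (Function.update (z t) i 0 l) (1 : ℝ)
      - ∑ ω, M.weight ω • M.certWeight lam τ i α β j b ω
        • EuclideanSpace.single (Function.update ω i 0 l) (1 : ℝ))‖ ≤ d)
    (hP : ∑ t, M.certCost lam τ i α β j b (z t) ≤ P) :
    N * (τ * (Real.exp (2 * lam) * k)⁻¹ * M.harmTotal i α β / 2
        * (center i w j b - (M.W i j α b - M.W i j β b)))
      ≤ 2 * (2 * lam * √(k : ℝ)) * d + P := by
  set D := w - M.trueParam i α β with hD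
  have hmin := hw.sum_le (M.norm21_trueParam_le hM i α β)
  -- Certificate weight and cost vanish on unselected samples. On the selected ones their
  -- combination lies below the excess loss over the truth, whose total is nonpositive by
  -- optimality.
  have hlow : ∑ t, (-(M.certWeight lam τ i α β j b (z t) * dot D (covariate i (z t)))
      - M.certCost lam τ i α β j b (z t)) ≤ 0 := by
    calc _ = ∑ t ∈ selected z i α β,
          (-(M.certWeight lam τ i α β j b (z t) * dot D (covariate i (z t)))
            - M.certCost lam τ i α β j b (z t)) := by
          refine (Finset.sum_subset (Finset.subset_univ _) fun t _ ht => ?_).symm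
          have : ¬ (z t i = α ∨ z t i = β) := by simpa [selected] using ht
          simp [Model.certWeight, Model.certCost, this]
      _ ≤ ∑ t ∈ selected z i α β, (sampleLoss i α w (z t)
            - sampleLoss i α (M.trueParam i α β) (z t)) :=
          Finset.sum_le_sum fun t ht =>
            M.loss_sub_ge hM hτ hτ1 hij b (by simpa [selected] using ht) w
      _ ≤ 0 := by rw [Finset.sum_sub_distrib]; linarith
  rw [Finset.sum_sub_distrib, Finset.sum_neg_distrib] at hlow
  have hdev := abs_sum_dot_sub_le M.weight (M.certWeight lam τ i α β j b) i D z hd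
  rw [M.sum_certWeight_mul_dot h hij lam τ b D, hD, center_sub hij,
    M.center_trueParam hij, ← hD] at hdev
  have hn : norm21 D ≤ 2 * (2 * lam * √(k : ℝ)) :=
    (norm21_sub_le _ _).trans (by linarith [hw.1, M.norm21_trueParam_le hM i α β])
  have := mul_le_mul_of_nonneg_right hn hd0
  linarith [le_abs_self (∑ t, M.certWeight lam τ i α β j b (z t) * dot D (covariate i (z t))
    - N * -(τ * (Real.exp (2 * lam) * k)⁻¹ * M.harmTotal i α β / 2
        * (center i w j b - (M.W i j α b - M.W i j β b))))]

/-- Shrinking one entry of a minimizer does not decrease the loss. -/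
lemma IsConstrainedMinimizer.card_le_sum {lam : ℝ} {z : Fin N → Fin n → Fin k} {i : Fin n}
    {α β : Fin k} {w : Matrix (Fin n) (Fin k) ℝ}
    (hw : IsConstrainedMinimizer lam z i α β w) (r : Fin n) (b : Fin k) {s : ℝ} (hs : 0 < s)
    (hsw : s ≤ w r b) :
    (∑ t ∈ (selected z i α β).filter (fun t => Function.update (z t) i 0 r = b),
        if z t i = α then (0 : ℝ) else 1)
      ≤ ∑ t ∈ (selected z i α β).filter (fun t => Function.update (z t) i 0 r = b),
        1 / (1 + Real.exp (dot w (covariate i (z t)) - s)) := by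
  set v : Matrix (Fin n) (Fin k) ℝ :=
    fun l a => if l = r ∧ a = b then w l a - s else w l a with hv
  have hvw : ∀ l a, |v l a| ≤ |w l a| := fun l a => by
    simp only [hv]
    split_ifs with h
    · rw [h.1, h.2, abs_of_nonneg (hs.le.trans hsw), abs_of_nonneg (sub_nonneg.mpr hsw)]
      linarith
    · exact le_rfl
  have hnorm : norm21 v ≤ 2 * lam * √(k : ℝ) := by
    refine le_trans ?_ hw.1
    exact Finset.sum_le_sum fun l _ => Real.sqrt_le_sqrt
      (Finset.sum_le_sum fun a _ => sq_le_sq.mpr (hvw l a))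
  have hdot : ∀ x : Fin n → Fin k, dot v (covariate i x)
      = dot w (covariate i x) - if Function.update x i 0 r = b then s else 0 := by
    intro x
    rw [dot_covariate, dot_covariate, ← Finset.add_sum_erase _ _ (Finset.mem_univ r),
      ← Finset.add_sum_erase Finset.univ (fun l => w l (Function.update x i 0 l))
        (Finset.mem_univ r)]
    have h1 : ∀ l ∈ Finset.univ.erase r, v l (Function.update x i 0 l)
        = w l (Function.update x i 0 l) := fun l hl => by
      simp [hv, Finset.ne_of_mem_erase hl]
    rw [Finset.sum_congr rfl h1]
    simp only [hv, true_and]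
    split_ifs <;> ring
  have hmin := hw.sum_le hnorm
  rw [← sub_nonpos, ← Finset.sum_sub_distrib] at hmin
  have hterm : ∀ t, -(s * if Function.update (z t) i 0 r = b then
      (1 / (1 + Real.exp (dot w (covariate i (z t)) - s)) - if z t i = α then (0 : ℝ) else 1)
        else 0) ≤ sampleLoss i α w (z t) - sampleLoss i α v (z t) := by
    intro t
    by_cases hb : Function.update (z t) i 0 r = b
    · have hval := hdot (z t)
      rw [if_pos hb] at hval
      set y := label i α (z t) with hy
      set p := 1 / (1 + Real.exp (y * dot v (covariate i (z t)))) with hp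
      have hE := Real.exp_pos (y * dot v (covariate i (z t)))
      -- With the slope at `v` itself the chi-squared term vanishes: this is the tangent bound at
      -- the shrunken point `v`.
      have h1 := log_one_add_exp_sub_ge (u := y * dot w (covariate i (z t))) (q := p) hp
        (by positivity) (by rw [hp, div_lt_one (by positivity)]; linarith)
      rw [sub_self, zero_pow two_ne_zero, zero_div, sub_zero] at h1
      refine le_trans (le_of_eq ?_) h1
      rw [if_pos hb, ← hval, ← mul_sub, hval, sub_sub_cancel, ← hval, hp, hy]
      unfold label
      by_cases ha : z t i = α
      · simp only [ha, if_true]; ring_nf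
      · simp only [ha, if_false]
        have hE' := Real.exp_pos (dot v (covariate i (z t)))
        rw [neg_one_mul, Real.exp_neg]
        field_simp
        ring
    · have hval := hdot (z t)
      rw [if_neg hb, sub_zero] at hval
      simp [hb, sampleLoss, hval]
  have h2 := (Finset.sum_le_sum fun t (_ : t ∈ selected z i α β) => hterm t).trans hmin
  rw [Finset.sum_neg_distrib, ← Finset.mul_sum, neg_nonpos] at h2
  have h3 := nonneg_of_mul_nonneg_right h2 hs
  rw [← Finset.sum_filter, Finset.sum_sub_distrib] at h3
  linarith

/-- A prediction with margin `s` reduced by noise `o`. The bound is linear in `o`, so the noise only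
needs to be controlled in total over the samples. -/
lemma one_div_one_add_exp_le {f s o : ℝ} (hs : 0 < s) (ho : 0 ≤ o) (hf : s - o ≤ f) :
    1 / (1 + Real.exp f) ≤ (1 + o) / s := by
  rw [div_le_div_iff₀ (by positivity) hs, one_mul]
  have h1 := Real.add_one_le_exp f
  have h2 := Real.exp_pos f
  rcases le_total s o with h | h
  · nlinarith
  · nlinarith [mul_nonneg ho (sub_nonneg.mpr h)]

omit [NeZero k] in
/-- The total of one row of `w` over samples in which no letter is frequent. -/
lemma sum_abs_row_le (w : Matrix (Fin n) (Fin k) ℝ) (l : Fin n) (T : Finset (Fin N))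
    (z : Fin N → Fin n → Fin k) {X : ℝ}
    (hX : ∀ a, ((T.filter fun t => z t l = a).card : ℝ) ≤ X) :
    ∑ t ∈ T, |w l (z t l)| ≤ √(∑ a, w l a ^ 2) * √(X * T.card) := by
  have h1 : ∑ t ∈ T, |w l (z t l)| = ∑ a, |w l a| * ((T.filter fun t => z t l = a).card : ℝ) := by
    rw [← Finset.sum_fiberwise T (fun t => z t l)]
    refine Finset.sum_congr rfl fun a _ => ?_
    rw [Finset.sum_congr rfl (g := fun _ => |w l a|)]
    · rw [Finset.sum_const, nsmul_eq_mul, mul_comm]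
    · intro t ht; rw [(Finset.mem_filter.mp ht).2]
  have h2 : ∑ a, ((T.filter fun t => z t l = a).card : ℝ) = T.card := by
    rw [← Nat.cast_sum, ← Finset.card_eq_sum_card_fiberwise
      fun t _ => Finset.mem_coe.mpr (Finset.mem_univ (z t l))]
  rw [h1]
  -- Cauchy–Schwarz over letters; a squared letter count is at most `X` times the count, and the
  -- counts add up to `T.card`.
  refine (Real.sum_mul_le_sqrt_mul_sqrt _ _ _).trans ?_
  simp_rw [sq_abs]
  refine mul_le_mul_of_nonneg_left (Real.sqrt_le_sqrt ?_) (Real.sqrt_nonneg _)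
  rw [← h2, Finset.mul_sum]
  refine Finset.sum_le_sum fun a _ => ?_
  rw [sq]
  exact mul_le_mul_of_nonneg_right (hX a) (Nat.cast_nonneg _)

/-- If the entry `(r, b)` of a minimizer dominates the prediction on all samples that contain it,
then few of these samples are labelled `β`. -/
lemma IsConstrainedMinimizer.card_mul_le {lam : ℝ} {z : Fin N → Fin n → Fin k}
    {i : Fin n} {α β : Fin k} {w : Matrix (Fin n) (Fin k) ℝ}
    (hw : IsConstrainedMinimizer lam z i α β w) (r : Fin n) (b : Fin k) {s : ℝ} (hs : 0 < s)
    (hsw : s ≤ w r b) (E : Finset (Fin n)) {T : Finset (Fin N)}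
    (hT : T = (selected z i α β).filter (fun t => Function.update (z t) i 0 r = b))
    (hdom : ∀ t ∈ T, s - ∑ l ∈ Eᶜ, |w l (z t l)| ≤ dot w (covariate i (z t)) - s)
    {X : ℝ} (hX : ∀ l ∈ Eᶜ, ∀ a, ((T.filter fun t => z t l = a).card : ℝ) ≤ X) :
    (∑ t ∈ T, if z t i = α then (0 : ℝ) else 1) * s
      ≤ T.card + 2 * lam * √(k : ℝ) * √(X * T.card) := by
  have h1 := hw.card_le_sum r b hs hsw
  rw [← hT] at h1
  rw [← le_div_iff₀ hs]
  refine h1.trans ?_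
  calc ∑ t ∈ T, 1 / (1 + Real.exp (dot w (covariate i (z t)) - s))
      ≤ ∑ t ∈ T, (1 + ∑ l ∈ Eᶜ, |w l (z t l)|) / s :=
        Finset.sum_le_sum fun t ht => one_div_one_add_exp_le hs
          (Finset.sum_nonneg fun _ _ => abs_nonneg _) (hdom t ht)
    _ = (T.card + ∑ l ∈ Eᶜ, ∑ t ∈ T, |w l (z t l)|) / s := by
        rw [← Finset.sum_div, Finset.sum_add_distrib, Finset.sum_comm (s := T)]
        simp
    _ ≤ (T.card + 2 * lam * √(k : ℝ) * √(X * T.card)) / s := by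
        gcongr
        calc ∑ l ∈ Eᶜ, ∑ t ∈ T, |w l (z t l)|
            ≤ ∑ l ∈ Eᶜ, √(∑ a, w l a ^ 2) * √(X * T.card) :=
              Finset.sum_le_sum fun l hl => sum_abs_row_le w l T z (hX l hl)
          _ ≤ norm21 w * √(X * T.card) := by
              rw [← Finset.sum_mul]
              gcongr
              exact Finset.sum_le_univ_sum_of_nonneg fun _ => Real.sqrt_nonneg _
          _ ≤ _ := by gcongr; exact hw.1

end

section

/-! ### Overshooting minimizers are unlikely when `η` is moderate -/

section Bernstein

variable {H : Type*} [NormedAddCommGroup H] [InnerProductSpace ℝ H] {Ω : Type*} [Fintype Ω]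

/-- Bernstein's inequality for the deviation of a sum of vectors in the unit ball. -/
lemma iidProb_norm_sum_sub_mean_ge_le {μ : Ω → ℝ} (hμ : ∀ ω, 0 ≤ μ ω) (h1 : ∑ ω, μ ω = 1)
    (X : Ω → H) (hX : ∀ ω, ‖X ω‖ ≤ 1) {v : ℝ} (hv0 : 0 < v) (hv : ∑ ω, μ ω * ‖X ω‖ ^ 2 ≤ v)
    {N : ℕ} (hN : 0 < N) {d : ℝ} (hd0 : 0 ≤ d) (hd : d ≤ N * v) :
    iidProb μ N {z | d ≤ ‖∑ t, (X (z t) - ∑ ω, μ ω • X ω)‖}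
      ≤ 2 * Real.exp (-(d ^ 2 / (4 * (N * v)))) := by
  set m := ∑ ω, μ ω • X ω with hm
  have hm1 : ‖m‖ ≤ 1 := by
    calc ‖m‖ ≤ ∑ ω, μ ω * ‖X ω‖ := (norm_sum_le _ _).trans (Finset.sum_le_sum fun ω _ => by
          rw [norm_smul, Real.norm_of_nonneg (hμ ω)])
      _ ≤ ∑ ω, μ ω * 1 := Finset.sum_le_sum fun ω _ =>
          mul_le_mul_of_nonneg_left (hX ω) (hμ ω)
      _ = 1 := by simp [h1]
  refine iidProb_norm_sum_ge_le hμ h1 (fun ω => X ω - m) ?_ ?_ hv0 ?_ hN hd0 hd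
  · simp_rw [smul_sub, Finset.sum_sub_distrib, ← Finset.sum_smul, h1, one_smul]
    exact sub_self _
  · intro ω
    linarith [norm_sub_le (X ω) m, hX ω]
  · refine le_trans ?_ hv
    have h : ∑ ω, μ ω * ‖X ω - m‖ ^ 2 = ∑ ω, μ ω * ‖X ω‖ ^ 2 - ‖m‖ ^ 2 := by
      have h2 : ∀ ω, μ ω * ‖X ω - m‖ ^ 2
          = μ ω * ‖X ω‖ ^ 2 - 2 * inner ℝ (μ ω • X ω) m + μ ω * ‖m‖ ^ 2 := fun ω => by
        rw [norm_sub_sq_real, real_inner_smul_left]; ring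
      simp_rw [h2, Finset.sum_add_distrib, Finset.sum_sub_distrib, ← Finset.mul_sum,
        ← Finset.sum_mul, ← sum_inner, h1, ← hm, real_inner_self_eq_norm_sq]
      ring
    rw [h]
    linarith [sq_nonneg ‖m‖]

end Bernstein

variable {n k N : ℕ} [NeZero k]

/-- The samples for which some minimizer exceeds the true value of a centred entry by more than
`η / 2`. -/
def overshoot (M : Model n k) (N : ℕ) (lam η : ℝ) (i : Fin n) (α β : Fin k) (j : Fin n)
    (b : Fin k) : Set (Fin N → Fin n → Fin k) :=
  {z | ∃ w, IsConstrainedMinimizer lam z i α β w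
    ∧ η / 2 < center i w j b - (M.W i j α b - M.W i j β b)}

/-- An overshoot forces either an empirical cost above four times the bound on its mean or a
deviation of some row vector by `d`: a Chernoff event and `n` Bernstein events. -/
lemma iidProb_overshoot_le_of_small (M : Model n k) {lam η B : ℝ} (hM : M.width ≤ lam)
    (hlam : 0 < lam) (hη : 0 < η) (hηk : η ≤ 12 * lam * √(k : ℝ)) {i j : Fin n} (hij : j ≠ i)
    {α β : Fin k} (h : α ≠ β) (b : Fin k) (hN : 0 < N)
    (hB1 : B ≤ N * ((Real.exp (2 * lam) * k)⁻¹) ^ 2)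
    (hB2 : B * (2 ^ 22 * lam ^ 2 * k)
      ≤ η ^ 2 * min η 1 ^ 2 * (N * ((Real.exp (2 * lam) * k)⁻¹) ^ 3)) :
    iidProb M.weight N (overshoot M N lam η i α β j b)
      ≤ (2 * n + 1) * Real.exp (-B) := by
  have hμ := fun z => (M.weight_pos z).le
  have hk : (0 : ℝ) < k := by exact_mod_cast NeZero.pos k
  have hk1 : (1 : ℝ) ≤ k := by exact_mod_cast NeZero.one_le
  have hNr : (0 : ℝ) < N := by exact_mod_cast hN
  have hsk : 0 < √(k : ℝ) := Real.sqrt_pos.mpr hk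
  set δ := (Real.exp (2 * lam) * k)⁻¹ with hδ
  have hδ0 : 0 < δ := by positivity
  have hδ1 : δ ≤ 1 := by
    rw [hδ]
    exact inv_le_one_of_one_le₀ (by nlinarith [Real.one_le_exp (x := 2 * lam) (by linarith)])
  set v := M.harmTotal i α β with hv
  have hvδ : δ ≤ v := M.harmTotal_ge hM h
  have hv0 : 0 < v := hδ0.trans_le hvδ
  set m := min η 1 with hm
  have hm0 : 0 < m := lt_min hη one_pos
  have hm1 : m ≤ 1 := min_le_right _ _
  have hmη : m ≤ η := min_le_left _ _
  -- Small enough that the cost uses at most half of the available signal.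
  set τ := m / 16 with hτ
  have hτ0 : 0 < τ := by positivity
  have hτ1 : τ < 1 := by rw [hτ]; linarith
  set R := 2 * lam * √(k : ℝ) with hR
  have hR0 : 0 < R := by positivity
  have hRsq : R ^ 2 = 4 * lam ^ 2 * k := by
    rw [hR, mul_pow, Real.sq_sqrt hk.le]; ring
  -- Chosen so that the fluctuation `2 * R * d` equals the other half of the signal.
  set d := η * τ * δ * v * N / (16 * R) with hd
  have hd0 : 0 < d := by positivity
  have hsub : overshoot M N lam η i α β j b ⊆
      {z | 2 * (N * (δ * v)) ≤ ∑ t, M.certCost lam τ i α β j b (z t) / τ ^ 2}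
      ∪ ⋃ l : Fin n, {z | d ≤ ‖∑ t, (M.certWeight lam τ i α β j b (z t)
        • EuclideanSpace.single (Function.update (z t) i 0 l) (1 : ℝ)
      - ∑ ω, M.weight ω • M.certWeight lam τ i α β j b ω
        • EuclideanSpace.single (Function.update ω i 0 l) (1 : ℝ))‖} := by
    rintro z ⟨w, hw, hlt⟩
    by_contra hz
    rw [Set.mem_union, not_or, Set.mem_iUnion, not_exists] at hz
    obtain ⟨hz1, hz2⟩ := hz
    simp only [Set.mem_ofPred_eq, not_le] at hz1 hz2
    rw [← Finset.sum_div, div_lt_iff₀ (by positivity)] at hz1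
    have hkey := hw.center_sub_le M hM hτ0.le hτ1 hij h b hd0.le (fun l => (hz2 l).le) hz1.le
    rw [← hδ, ← hv, ← hR] at hkey
    have hfac : 0 < N * (τ * δ * v / 2) := by positivity
    have h1 : N * (τ * δ * v / 2) * (η / 2) < 2 * R * d + 2 * (N * (δ * v)) * τ ^ 2 := by
      refine lt_of_lt_of_le (mul_lt_mul_of_pos_left hlt hfac) (le_trans (le_of_eq ?_) hkey)
      ring
    have h2 : 2 * R * d = N * (τ * δ * v / 2) * (η / 4) := by
      rw [hd]; field_simp; ring
    have h3 : 2 * (N * (δ * v)) * τ ^ 2 ≤ N * (τ * δ * v / 2) * (η / 4) := by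
      have h4 : 2 * (N * (δ * v)) * τ ^ 2 = N * (τ * δ * v / 2) * (4 * τ) := by ring
      rw [h4]
      gcongr
      rw [hτ]; linarith
    linarith
  have hp1 : iidProb M.weight N
      {z | 2 * (N * (δ * v)) ≤ ∑ t, M.certCost lam τ i α β j b (z t) / τ ^ 2}
      ≤ Real.exp (-B) := by
    have hmean : ∑ ω, M.weight ω * (M.certCost lam τ i α β j b ω / τ ^ 2) ≤ δ * v / 2 := by
      simp_rw [← mul_div_assoc]
      rw [← Finset.sum_div, div_le_iff₀ (by positivity), mul_comm _ (τ ^ 2)]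
      exact M.sum_certCost_le hM h hij b
    refine (iidProb_sum_ge_le hμ M.sum_weight N
      (Y := fun ω => M.certCost lam τ i α β j b ω / τ ^ 2)
      (fun ω => div_nonneg (M.certCost_nonneg _ _ _ _ _) (sq_nonneg _))
      (fun ω => (div_le_one (by positivity)).mpr (M.certCost_le hM hτ0.le hij b ω))
      hmean _).trans (Real.exp_le_exp.mpr ?_)
    have : N * δ ^ 2 ≤ N * (δ * v) := by rw [sq]; gcongr
    linarith
  have hp2 : ∀ l : Fin n, iidProb M.weight N
      {z | d ≤ ‖∑ t, (M.certWeight lam τ i α β j b (z t)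
        • EuclideanSpace.single (Function.update (z t) i 0 l) (1 : ℝ)
      - ∑ ω, M.weight ω • M.certWeight lam τ i α β j b ω
        • EuclideanSpace.single (Function.update ω i 0 l) (1 : ℝ))‖} ≤ 2 * Real.exp (-B) := by
    intro l
    refine (iidProb_norm_sum_sub_mean_ge_le hμ M.sum_weight
      (fun ω => M.certWeight lam τ i α β j b ω
        • EuclideanSpace.single (Function.update ω i 0 l) (1 : ℝ)) ?_ (v := 4 * v)
      (by positivity) ?_ hN hd0.le ?_).trans ?_
    · intro ω
      rw [norm_smul, PiLp.norm_single, norm_one, mul_one]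
      exact (M.abs_certWeight_le hM hτ0.le hτ1 hij b ω).1
    · rw [hv, Model.harmTotal, Finset.mul_sum]
      refine Finset.sum_le_sum fun ω _ => ?_
      rw [norm_smul, PiLp.norm_single, norm_one, mul_one, Real.norm_eq_abs, sq_abs]
      refine (M.abs_certWeight_le hM hτ0.le hτ1 hij b ω).2.trans (le_of_eq ?_)
      split_ifs <;> simp
    · rw [hd, div_le_iff₀ (by positivity)]
      -- This keeps `d` within the Gaussian range of Bernstein's inequality.
      have h1 : η ≤ 6 * R := by rw [hR]; linarith
      have h2 : τ * δ ≤ 1 := by nlinarith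
      calc η * τ * δ * v * N = η * (τ * δ) * (v * N) := by ring
        _ ≤ 6 * R * 1 * (v * N) := by gcongr
        _ ≤ N * (4 * v) * (16 * R) := by nlinarith [mul_pos (mul_pos hv0 hNr) hR0]
    · gcongr
      rw [le_div_iff₀ (by positivity)]
      have h1 : d ^ 2 = η ^ 2 * m ^ 2 * (N * δ ^ 2 * v) * (v * N) / (2 ^ 18 * lam ^ 2 * k) := by
        rw [hd, div_pow, mul_pow (16 : ℝ), hRsq, hτ]; field_simp; ring
      rw [h1, le_div_iff₀ (by positivity)]
      have h2 : N * δ ^ 3 ≤ N * δ ^ 2 * v := by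
        rw [pow_succ, ← mul_assoc]; gcongr
      calc B * (4 * (N * (4 * v))) * (2 ^ 18 * lam ^ 2 * k)
          = B * (2 ^ 22 * lam ^ 2 * k) * (v * N) := by ring
        _ ≤ η ^ 2 * m ^ 2 * (N * δ ^ 3) * (v * N) := by gcongr
        _ ≤ η ^ 2 * m ^ 2 * (N * δ ^ 2 * v) * (v * N) := by gcongr
  calc _ ≤ _ := iidProb_mono hμ hsub
    _ ≤ _ := iidProb_union_le hμ _ _
    _ ≤ Real.exp (-B) + Fintype.card (Fin n) * (2 * Real.exp (-B)) :=
        add_le_add hp1 (iidProb_iUnion_le hμ _ hp2)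
    _ = (2 * n + 1) * Real.exp (-B) := by rw [Fintype.card_fin]; ring

end

section

/-! ### Overshooting minimizers are unlikely when `η` is large -/

variable {n k N : ℕ} [NeZero k]

/-! ### Probabilities of events under a change of one letter -/

namespace Model

variable (M : Model n k)

/-- The probability of a predicate. -/
def mass (p : (Fin n → Fin k) → Prop) [DecidablePred p] : ℝ :=
  ∑ z, M.weight z * if p z then 1 else 0

variable (p : (Fin n → Fin k) → Prop) [DecidablePred p]

lemma mass_nonneg : 0 ≤ M.mass p :=
  Finset.sum_nonneg fun z _ => mul_nonneg (M.weight_pos z).le (by split_ifs <;> norm_num)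

lemma mass_true : M.mass (fun _ => True) = 1 := by
  simp [mass, M.sum_weight]

variable {p} {l : Fin n} (hp : ∀ z a, p (Function.update z l a) ↔ p z)

include hp

omit [NeZero k] in
lemma mass_and_eq (a : Fin k) :
    k * M.mass (fun z => p z ∧ z l = a)
      = ∑ z, M.weight (Function.update z l a) * if p z then 1 else 0 := by
  unfold mass
  rw [← sum_sum_update l]
  refine Finset.sum_congr rfl fun z _ => ?_
  rw [Finset.sum_eq_single a]
  · simp [hp]
  · intro c _ hc; simp [hc]
  · simp

lemma mass_and_le {lam : ℝ} (hM : M.width ≤ lam) (a : Fin k) :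
    M.mass (fun z => p z ∧ z l = a) ≤ Real.exp (2 * lam) / k * M.mass p := by
  have hk : (0 : ℝ) < k := by exact_mod_cast NeZero.pos k
  rw [div_mul_eq_mul_div, le_div_iff₀ hk, mul_comm _ (k : ℝ), M.mass_and_eq hp, mass,
    Finset.mul_sum]
  refine Finset.sum_le_sum fun z _ => ?_
  rw [← mul_assoc]
  exact mul_le_mul_of_nonneg_right (M.weight_update_le hM l z a) (by split_ifs <;> norm_num)

lemma le_mass_and {lam : ℝ} (hM : M.width ≤ lam) (a : Fin k) :
    (Real.exp (2 * lam) * k)⁻¹ * M.mass p ≤ M.mass (fun z => p z ∧ z l = a) := by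
  have hk : (0 : ℝ) < k := by exact_mod_cast NeZero.pos k
  rw [inv_mul_le_iff₀ (mul_pos (Real.exp_pos _) hk), mul_assoc, M.mass_and_eq hp, mass,
    Finset.mul_sum]
  refine Finset.sum_le_sum fun z _ => ?_
  rw [← mul_assoc]
  refine mul_le_mul_of_nonneg_right ?_ (by split_ifs <;> norm_num)
  simpa using M.weight_update_le hM l (Function.update z l a) (z l)

/-- Both labels keep a fraction of at least `exp (-2 lam) / 2`, even after conditioning on an event
that ignores letter `l`. -/
lemma mass_pair_le {lam : ℝ} (hM : M.width ≤ lam) (hlam : 0 ≤ lam) (α β : Fin k) :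
    M.mass (fun z => p z ∧ (z l = α ∨ z l = β))
      ≤ 2 * Real.exp (2 * lam) * M.mass (fun z => p z ∧ z l = β) := by
  have hk : (0 : ℝ) < k := by exact_mod_cast NeZero.pos k
  have h1 : M.mass (fun z => p z ∧ (z l = α ∨ z l = β))
      ≤ M.mass (fun z => p z ∧ z l = α) + M.mass (fun z => p z ∧ z l = β) := by
    unfold mass
    rw [← Finset.sum_add_distrib]
    refine Finset.sum_le_sum fun z _ => ?_
    rw [← mul_add]
    refine mul_le_mul_of_nonneg_left ?_ (M.weight_pos z).le
    by_cases h1 : p z <;> by_cases h2 : z l = α <;> by_cases h3 : z l = β <;>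
      simp only [h1, h2, h3, true_or, or_true, and_true, and_false, if_true, if_false,
        or_self] <;> norm_num <;> split_ifs <;> norm_num
  have h2 : k * M.mass (fun z => p z ∧ z l = α)
      ≤ k * (Real.exp (2 * lam) * M.mass (fun z => p z ∧ z l = β)) := by
    rw [mul_left_comm, M.mass_and_eq hp, M.mass_and_eq hp, Finset.mul_sum]
    refine Finset.sum_le_sum fun z _ => ?_
    rw [← mul_assoc]
    refine mul_le_mul_of_nonneg_right ?_ (by split_ifs <;> norm_num)
    simpa using M.weight_update_le hM l (Function.update z l β) α
  have h3 := le_of_mul_le_mul_left h2 hk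
  have h4 := Real.one_le_exp (x := 2 * lam) (by linarith)
  have h5 := M.mass_nonneg (fun z => p z ∧ z l = β)
  nlinarith

end Model

/-! ### Typical sample counts -/

/-- The number of samples that satisfy a predicate. -/
def count (z : Fin N → Fin n → Fin k) (p : (Fin n → Fin k) → Prop) [DecidablePred p] : ℝ :=
  ∑ t, if p (z t) then 1 else 0

lemma iidProb_count_ge_le (M : Model n k) (p : (Fin n → Fin k) → Prop) [DecidablePred p]
    {m : ℝ} (hm : M.mass p ≤ m) (T : ℝ) :
    iidProb M.weight N {z | T ≤ count z p} ≤ Real.exp (2 * (N * m) - T) :=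
  iidProb_sum_ge_le (fun z => (M.weight_pos z).le) M.sum_weight N
    (Y := fun z => if p z then 1 else 0) (fun z => by split_ifs <;> norm_num)
    (fun z => by split_ifs <;> norm_num) hm T

lemma iidProb_count_le_le (M : Model n k) (p : (Fin n → Fin k) → Prop) [DecidablePred p]
    (T : ℝ) :
    iidProb M.weight N {z | count z p ≤ T} ≤ Real.exp (T - 5 / 8 * (N * M.mass p)) :=
  iidProb_sum_le_le (fun z => (M.weight_pos z).le) M.sum_weight N
    (Y := fun z => if p z then 1 else 0) (fun z => by split_ifs <;> norm_num)
    (fun z => by split_ifs <;> norm_num) le_rfl T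

/-- The samples with atypical counts among those that satisfy `p` and have `α` or `β` at `i`. -/
def atypical (M : Model n k) (N : ℕ) (p : (Fin n → Fin k) → Prop) [DecidablePred p] (i : Fin n)
    (α β : Fin k) (E : Finset (Fin n)) (X : ℝ) : Set (Fin N → Fin n → Fin k) :=
  ({z | count z (fun x => p x ∧ x i = β) ≤ N * M.mass (fun x => p x ∧ x i = β) / 2}
    ∪ {z | 3 * (N * M.mass (fun x => p x ∧ (x i = α ∨ x i = β)))
        ≤ count z (fun x => p x ∧ (x i = α ∨ x i = β))})
  ∪ ⋃ q : Fin n × Fin k, {z | q.1 ∉ E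
      ∧ X ≤ count z (fun x => (p x ∧ (x i = α ∨ x i = β)) ∧ x q.1 = q.2)}

/-- Chernoff for `2 + n * k` counts. A letter outside `E` has conditional frequency at most `exp (2
* lam) / k`, so `X` is at least four times its expected count. -/
lemma iidProb_atypical_le (M : Model n k) {lam B X : ℝ} (hM : M.width ≤ lam)
    (p : (Fin n → Fin k) → Prop) [DecidablePred p] {i : Fin n} (α β : Fin k)
    {E : Finset (Fin n)} (hi : i ∈ E)
    (hp : ∀ l ∉ E, ∀ z a, p (Function.update z l a) ↔ p z)
    (hB1 : 8 * B ≤ N * M.mass (fun x => p x ∧ x i = β))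
    (hB2 : B ≤ N * M.mass (fun x => p x ∧ (x i = α ∨ x i = β)))
    (hX1 : 4 * (N * (Real.exp (2 * lam) / k * M.mass (fun x => p x ∧ (x i = α ∨ x i = β)))) ≤ X)
    (hX2 : 2 * B ≤ X) :
    iidProb M.weight N (atypical M N p i α β E X) ≤ (2 + n * k) * Real.exp (-B) := by
  have hμ := fun z => (M.weight_pos z).le
  have h1 := iidProb_count_le_le (N := N) M (fun x => p x ∧ x i = β)
    (N * M.mass (fun x => p x ∧ x i = β) / 2)
  have h2 := iidProb_count_ge_le (N := N) M (fun x => p x ∧ (x i = α ∨ x i = β)) le_rfl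
    (3 * (N * M.mass (fun x => p x ∧ (x i = α ∨ x i = β))))
  have h3 : ∀ q : Fin n × Fin k, iidProb M.weight N {z | q.1 ∉ E
      ∧ X ≤ count z (fun x => (p x ∧ (x i = α ∨ x i = β)) ∧ x q.1 = q.2)}
      ≤ Real.exp (-B) := by
    intro q
    by_cases hq : q.1 ∈ E
    · simp [hq, iidProb, Real.exp_nonneg]
    · have hqi : i ≠ q.1 := fun h => hq (h ▸ hi)
      refine (iidProb_mono hμ fun z hz => hz.2).trans ((iidProb_count_ge_le M _
        (M.mass_and_le (fun z a => ?_) hM q.2) X).trans (Real.exp_le_exp.mpr (by linarith)))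
      rw [hp q.1 hq, Function.update_of_ne hqi]
  calc _ ≤ _ := iidProb_union_le hμ _ _
    _ ≤ (Real.exp (-B) + Real.exp (-B)) + Fintype.card (Fin n × Fin k) * Real.exp (-B) := by
        refine add_le_add ((iidProb_union_le hμ _ _).trans (add_le_add (h1.trans ?_)
          (h2.trans ?_))) (iidProb_iUnion_le hμ _ h3)
        · exact Real.exp_le_exp.mpr (by linarith)
        · exact Real.exp_le_exp.mpr (by linarith)
    _ = _ := by rw [Fintype.card_prod, Fintype.card_fin, Fintype.card_fin]; push_cast; ring

lemma dot_covariate_ge (w : Matrix (Fin n) (Fin k) ℝ) {i : Fin n} {E : Finset (Fin n)}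
    (hi : i ∈ E) (x : Fin n → Fin k) :
    ∑ l ∈ E, w l (Function.update x i 0 l) - ∑ l ∈ Eᶜ, |w l (x l)|
      ≤ dot w (covariate i x) := by
  rw [dot_covariate, ← Finset.sum_add_sum_compl E, sub_eq_add_neg, ← Finset.sum_neg_distrib]
  refine add_le_add_right (Finset.sum_le_sum fun l hl => ?_) _
  rw [Function.update_of_ne (fun h => Finset.mem_compl.mp hl (by rw [h]; exact hi))]
  exact neg_abs_le _

/-- In typical samples, no entry of a minimizer dominates the prediction. -/
lemma IsConstrainedMinimizer.mem_atypical (M : Model n k) {lam s : ℝ} (hM : M.width ≤ lam)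
    (hlam : 0 < lam) (p : (Fin n → Fin k) → Prop) [DecidablePred p] {z : Fin N → Fin n → Fin k}
    {i : Fin n} {α β : Fin k} (h : α ≠ β) {w : Matrix (Fin n) (Fin k) ℝ}
    (hw : IsConstrainedMinimizer lam z i α β w) (r : Fin n) (b : Fin k)
    (hs : 24 * Real.exp (2 * lam) ≤ s) (hsw : s ≤ w r b) {E : Finset (Fin n)} (hi : i ∈ E)
    (hpi : ∀ z a, p (Function.update z i a) ↔ p z)
    (hp : ∀ x : Fin n → Fin k, p x ↔ Function.update x i 0 r = b)
    (hdom : ∀ x, p x → 2 * s ≤ ∑ l ∈ E, w l (Function.update x i 0 l))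
    (hpos : 0 < N * M.mass (fun x => p x ∧ x i = β)) :
    z ∈ atypical M N p i α β E ((s / (16 * Real.exp (2 * lam) * (2 * lam * √(k : ℝ)))) ^ 2
      * (N * M.mass (fun x => p x ∧ (x i = α ∨ x i = β)))) := by
  have hk : (0 : ℝ) < k := by exact_mod_cast NeZero.pos k
  have hsk : 0 < √(k : ℝ) := Real.sqrt_pos.mpr hk
  have hpair := M.mass_pair_le hpi hM hlam.le α β
  have he := Real.exp_pos (2 * lam)
  have hs0 : 0 < s := by linarith
  set e := Real.exp (2 * lam) with hedef
  set R := 2 * lam * √(k : ℝ) with hR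
  have hR0 : 0 < R := by positivity
  set P := N * M.mass (fun x => p x ∧ (x i = α ∨ x i = β)) with hP
  set Q := N * M.mass (fun x => p x ∧ x i = β) with hQ
  have hPQ : P ≤ 2 * e * Q := by
    rw [hP, hQ, mul_left_comm]; gcongr
  -- With letter counts below `c² P` and fewer than `3 P` samples, the noise is at most `2 R c P = s
  -- P / (8 e)`. The samples themselves add `3 P ≤ s P / (8 e)`, while label `β` occurs more than `Q
  -- / 2 ≥ P / (4 e)` times: a contradiction.
  set c := s / (16 * e * R) with hc
  have hc0 : 0 < c := by positivity
  by_contra hz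
  simp only [atypical, Set.mem_union, Set.mem_iUnion, Set.mem_ofPred_eq, not_or, not_exists,
    not_and, not_le] at hz
  obtain ⟨⟨hz1, hz2⟩, hz3⟩ := hz
  set T : Finset (Fin N) := Finset.univ.filter fun t => p (z t) ∧ (z t i = α ∨ z t i = β) with hT
  have hTcard : (T.card : ℝ) = count z (fun x => p x ∧ (x i = α ∨ x i = β)) := by
    simp [hT, count]
  have hTsel : T = (selected z i α β).filter (fun t => Function.update (z t) i 0 r = b) := by
    ext t; simp [hT, selected, hp, and_comm]
  have hneg : (∑ t ∈ T, if z t i = α then (0 : ℝ) else 1)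
      = count z (fun x => p x ∧ x i = β) := by
    rw [hT, Finset.sum_filter, count]
    refine Finset.sum_congr rfl fun t _ => ?_
    by_cases h1 : p (z t) <;> by_cases h2 : z t i = α <;> by_cases h3 : z t i = β <;>
      simp_all
  have hkey := hw.card_mul_le r b hs0 hsw E hTsel (fun t ht => by
    have h1 := dot_covariate_ge w hi (z t)
    have h2 := hdom (z t) (Finset.mem_filter.mp ht).2.1
    linarith) (X := c ^ 2 * P) (fun l hl a => by
      have h1 := (hz3 (l, a) (Finset.mem_compl.mp hl)).le
      refine le_trans (le_of_eq ?_) h1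
      simp [hT, count, Finset.filter_filter])
  rw [hneg, hTcard] at hkey
  rw [← hR] at hkey
  set m := count z (fun x => p x ∧ (x i = α ∨ x i = β)) with hm
  have hP0 : 0 ≤ P := mul_nonneg (Nat.cast_nonneg _) (M.mass_nonneg _)
  have hsq : √(c ^ 2 * P * m) ≤ 2 * c * P := by
    rw [Real.sqrt_le_iff]
    refine ⟨by positivity, ?_⟩
    have : P * m ≤ P * (3 * P) := mul_le_mul_of_nonneg_left hz2.le hP0
    nlinarith [mul_le_mul_of_nonneg_left this (sq_nonneg c), mul_nonneg (sq_nonneg c)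
      (mul_nonneg hP0 hP0)]
  have h1 : R * √(c ^ 2 * P * m) ≤ s / (8 * e) * P := by
    calc R * √(c ^ 2 * P * m) ≤ R * (2 * c * P) := by gcongr
      _ = s / (8 * e) * P := by rw [hc]; field_simp; ring
  have h2 : 3 * P ≤ s / (8 * e) * P := by
    refine mul_le_mul_of_nonneg_right ?_ hP0
    rw [le_div_iff₀ (by positivity)]; linarith
  have h3 : s / (4 * e) * P ≤ s * (Q / 2) := by
    calc s / (4 * e) * P ≤ s / (4 * e) * (2 * e * Q) := by gcongr
      _ = s * (Q / 2) := by field_simp; ring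
  have h4 : s / (4 * e) * P = s / (8 * e) * P + s / (8 * e) * P := by field_simp; ring
  have h5 : Q / 2 * s < count z (fun x => p x ∧ x i = β) * s := mul_lt_mul_of_pos_right hz1 hs0
  linarith

lemma iidProb_overshoot_le_of_large (M : Model n k) {lam η B : ℝ} (hM : M.width ≤ lam)
    (hlam : 0 < lam) (hη : 1024 * Real.exp (4 * lam) ≤ η) {i j : Fin n} (hij : j ≠ i)
    {α β : Fin k} (h : α ≠ β) (b : Fin k) (hN : 0 < N) (hB0 : 0 ≤ B)
    (hB1 : 8 * B ≤ N * ((Real.exp (2 * lam) * k)⁻¹) ^ 2)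
    (hB2 : 2 ^ 19 * Real.exp (4 * lam) * lam ^ 2 * k * B
      ≤ η ^ 2 * (N * ((Real.exp (2 * lam) * k)⁻¹) ^ 2)) :
    iidProb M.weight N (overshoot M N lam η i α β j b)
      ≤ 2 * ((2 + n * k) * Real.exp (-B)) := by
  have hμ := fun z => (M.weight_pos z).le
  have hk : (0 : ℝ) < k := by exact_mod_cast NeZero.pos k
  have hk1 : (1 : ℝ) ≤ k := by exact_mod_cast NeZero.one_le
  have hNr : (0 : ℝ) < N := by exact_mod_cast hN
  have hsk : 0 < √(k : ℝ) := Real.sqrt_pos.mpr hk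
  have hlame : lam ≤ Real.exp lam := by linarith [Real.add_one_le_exp lam]
  have hel : Real.exp (4 * lam) = Real.exp (2 * lam) ^ 2 := by
    rw [← Real.exp_nat_mul]; congr 1; push_cast; ring
  have hel2 : Real.exp (2 * lam) = Real.exp lam ^ 2 := by
    rw [← Real.exp_nat_mul]; congr 1
  have hx1 : 1 ≤ Real.exp lam := Real.one_le_exp hlam.le
  have he1 : 1 ≤ Real.exp (2 * lam) := Real.one_le_exp (by linarith)
  set s := η / 16 with hs
  set δ := (Real.exp (2 * lam) * k)⁻¹ with hδ
  have hδ0 : 0 < δ := by positivity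
  have hδ1 : δ ≤ 1 := inv_le_one_of_one_le₀ (by nlinarith)
  rw [hel] at hη hB2
  set e := Real.exp (2 * lam) with he
  have hs24 : 24 * e ≤ s := by rw [hs]; nlinarith
  have hlam_e : lam ≤ e ^ 2 := by nlinarith [pow_le_pow_left₀ zero_le_one hx1 2]
  have hs0 : 0 < s := by linarith
  set R := 2 * lam * √(k : ℝ) with hR
  have hR0 : 0 < R := by positivity
  have hRsq : R ^ 2 = 4 * lam ^ 2 * k := by
    rw [hR, mul_pow, Real.sq_sqrt hk.le]; ring
  set c := s / (16 * e * R) with hc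
  have hcsq : c ^ 2 = η ^ 2 / (2 ^ 18 * e ^ 2 * lam ^ 2 * k) := by
    rw [hc, div_pow, mul_pow, hRsq, hs]; field_simp; ring
  -- This is where the threshold `1024 * exp (4 * lam)` comes from: with `lam² ≤ e` it makes the
  -- permitted letter count exceed four times the expected one.
  have hcX : 4 * (e / k) ≤ c ^ 2 := by
    have hle : lam ^ 2 ≤ e := by
      rw [hel2]; exact pow_le_pow_left₀ hlam.le hlame 2
    rw [hcsq, ← mul_div_assoc, div_le_div_iff₀ hk (by positivity)]
    have h1 : (1024 * e ^ 2) ^ 2 ≤ η ^ 2 := by gcongr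
    have h2 : 4 * e * (2 ^ 18 * e ^ 2 * lam ^ 2) ≤ (1024 * e ^ 2) ^ 2 := by
      have h3 : e ^ 3 * lam ^ 2 ≤ e ^ 3 * e := by gcongr
      nlinarith
    calc 4 * e * (2 ^ 18 * e ^ 2 * lam ^ 2 * k)
        = 4 * e * (2 ^ 18 * e ^ 2 * lam ^ 2) * k := by ring
      _ ≤ η ^ 2 * k := by gcongr; exact h2.trans h1
  have bound : ∀ (p : (Fin n → Fin k) → Prop) [DecidablePred p] (α β : Fin k)
      (E : Finset (Fin n)), i ∈ E → (∀ l ∉ E, ∀ z a, p (Function.update z l a) ↔ p z) →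
      δ ^ 2 ≤ M.mass (fun x => p x ∧ x i = β) →
      iidProb M.weight N (atypical M N p i α β E
        (c ^ 2 * (N * M.mass (fun x => p x ∧ (x i = α ∨ x i = β)))))
        ≤ (2 + n * k) * Real.exp (-B) := by
    intro p _ α β E hi hp hmass
    have hmono : M.mass (fun x => p x ∧ x i = β)
        ≤ M.mass (fun x => p x ∧ (x i = α ∨ x i = β)) := by
      refine Finset.sum_le_sum fun z _ => mul_le_mul_of_nonneg_left ?_ (hμ z)
      by_cases h1 : p z <;> by_cases h2 : z i = β <;> simp [h1, h2]
      split_ifs <;> norm_num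
    have h1 : N * δ ^ 2 ≤ N * M.mass (fun x => p x ∧ x i = β) := by gcongr
    have h2 : N * δ ^ 2 ≤ N * M.mass (fun x => p x ∧ (x i = α ∨ x i = β)) :=
      h1.trans (by gcongr)
    have h3 := M.mass_nonneg (fun x => p x ∧ (x i = α ∨ x i = β))
    refine iidProb_atypical_le M hM p α β hi hp (hB1.trans h1) (by linarith) ?_ ?_
    · calc _ = 4 * (e / k) * (N * M.mass (fun x => p x ∧ (x i = α ∨ x i = β))) := by ring
        _ ≤ _ := by gcongr
    · calc 2 * B ≤ c ^ 2 * (N * δ ^ 2) := by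
            rw [hcsq, div_mul_eq_mul_div, le_div_iff₀ (by positivity)]
            linarith
        _ ≤ _ := by gcongr
  have hm1 : ∀ c : Fin k, δ ≤ M.mass (fun x => True ∧ x i = c) := fun c => by
    have := M.le_mass_and (p := fun _ => True) (l := i) (fun _ _ => Iff.rfl) hM c
    rwa [M.mass_true, mul_one] at this
  have hm2 : δ ^ 2 ≤ M.mass (fun x => x j = b ∧ x i = β) := by
    have h1 := M.le_mass_and (p := fun _ => True) (l := j) (fun _ _ => Iff.rfl) hM b
    rw [M.mass_true, mul_one] at h1
    simp only [true_and] at h1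
    have h2 := M.le_mass_and (p := fun x => x j = b) (l := i)
      (fun z a => by rw [Function.update_of_ne hij]) hM β
    rw [sq]
    exact (mul_le_mul_of_nonneg_left h1 hδ0.le).trans h2
  have hsub : overshoot M N lam η i α β j b ⊆
      atypical M N (fun x => x j = b) i α β {i, j}
        (c ^ 2 * (N * M.mass (fun x => x j = b ∧ (x i = α ∨ x i = β))))
      ∪ atypical M N (fun _ => True) i β α {i}
        (c ^ 2 * (N * M.mass (fun x => True ∧ (x i = β ∨ x i = α)))) := by
    rintro z ⟨w, hw, hlt⟩
    have hmean := abs_le.mp (abs_row_mean_le w j)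
    have hmean2 : norm21 w / √(k : ℝ) ≤ 2 * lam := by
      rw [div_le_iff₀ hsk]; exact hw.1
    have hW1 := abs_le.mp (M.abs_W_le hM hij α b)
    have hW2 := abs_le.mp (M.abs_W_le hM hij β b)
    simp only [center, hij, if_false] at hlt
    have hlams : 128 * lam ≤ η := by nlinarith
    have hwjb : 4 * s ≤ w j b := by
      have : 4 * s = η / 4 := by rw [hs]; ring
      linarith
    -- The overshoot gives `w j b > 7 s`. If the constant entry is at least `-3 s`, the two together
    -- predict at least `2 s` on all words with letter `b` at `j`. Otherwise the constant entry of
    -- `-w` dominates on all words, in the regression with the labels exchanged.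
    by_cases hcase : -(2 * s) ≤ w i 0 + s
    · left
      refine hw.mem_atypical M hM hlam (fun x => x j = b) h j b hs24 (by linarith)
        (by simp) (fun z a => by rw [Function.update_of_ne hij])
        (fun x => by rw [Function.update_of_ne hij]) (fun x hx => ?_)
        (mul_pos hNr (lt_of_lt_of_le (by positivity) hm2))
      rw [Finset.sum_pair hij.symm, Function.update_self, Function.update_of_ne hij, hx]
      linarith
    · right
      refine (hw.swap h).mem_atypical M hM hlam (fun _ => True) h.symm i 0 hs24 ?_
        (by simp) (fun _ _ => Iff.rfl) (fun x => by simp) (fun x _ => ?_)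
        (mul_pos hNr (lt_of_lt_of_le hδ0 (hm1 α)))
      · rw [Matrix.neg_apply]; linarith
      · rw [Finset.sum_singleton, Function.update_self, Matrix.neg_apply]; linarith
  refine (iidProb_mono hμ hsub).trans ((iidProb_union_le hμ _ _).trans ?_)
  rw [two_mul]
  refine add_le_add (bound _ _ _ _ (by simp) ?_ hm2) (bound _ _ _ _ (by simp) ?_ ?_)
  · intro l hl z a
    simp only [Finset.mem_insert, Finset.mem_singleton, not_or] at hl
    rw [Function.update_of_ne (Ne.symm hl.2)]
  · intro l _ z a; exact Iff.rfl
  · exact le_trans (by nlinarith) (hm1 α)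

end

section

/-! ### The learning guarantee -/

variable {n k N : ℕ} [NeZero k]

/-- For a feasible `w` the entry is at most `2 lam √k`; the row mean and the true difference
contribute at most `2 lam` each, for a total of at most `6 lam √k < η / 2`. -/
lemma overshoot_eq_empty (M : Model n k) {lam η : ℝ} (hM : M.width ≤ lam) (hlam : 0 ≤ lam)
    (hη : 12 * lam * √(k : ℝ) < η) {i j : Fin n} (hij : j ≠ i) (α β b : Fin k) :
    overshoot M N lam η i α β j b = ∅ := by
  refine Set.eq_empty_of_forall_notMem ?_
  rintro z ⟨w, hw, hlt⟩
  have hk : (1 : ℝ) ≤ √(k : ℝ) := by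
    rw [Real.one_le_sqrt]; exact_mod_cast NeZero.one_le
  have hmean := abs_le.mp (abs_row_mean_le w j)
  have hmean2 : norm21 w / √(k : ℝ) ≤ 2 * lam := by
    rw [div_le_iff₀ (by linarith)]; exact hw.1
  have hW1 := abs_le.mp (M.abs_W_le hM hij α b)
  have hW2 := abs_le.mp (M.abs_W_le hM hij β b)
  have hwj := (abs_le.mp ((abs_le_norm21 w j b).trans hw.1)).2
  simp only [center, hij, if_false] at hlt
  have : lam ≤ lam * √(k : ℝ) := le_mul_of_one_le_right hlam hk
  linarith

/-- The probability that minimizers overshoot at a given entry. -/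
lemma iidProb_overshoot_le (M : Model n k) {lam η L : ℝ} (hM : M.width ≤ lam) (hη : 0 < η)
    (hL : 0 < L)
    (hN : 2 ^ 50 * (lam ^ 2 * (k : ℝ) ^ 4 * Real.exp (14 * lam) * L / η ^ 4) ≤ N)
    {i j : Fin n} (hij : j ≠ i) {α β : Fin k} (h : α ≠ β) (b : Fin k) :
    iidProb M.weight N (overshoot M N lam η i α β j b)
      ≤ 8 * (n * k) * Real.exp (-(10 * L)) := by
  have hlam0 := M.nonneg_of_width_le hM i
  have hk1 : (1 : ℝ) ≤ k := by exact_mod_cast NeZero.one_le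
  have hn1 : (1 : ℝ) ≤ n := by exact_mod_cast i.pos
  have hk : (0 : ℝ) < k := by linarith
  have hnk : (n : ℝ) ≤ n * k := le_mul_of_one_le_right (by linarith) hk1
  have hE := Real.exp_pos (-(10 * L))
  -- Beyond this value the constraint forbids overshoots. Below it `η² ≤ 144 lam² k`, which is used
  -- to trade powers of `η` in both remaining regimes.
  rcases lt_or_ge (12 * lam * √(k : ℝ)) η with hbig | hsmall
  · rw [overshoot_eq_empty M hM hlam0 hbig hij]
    simp only [iidProb, Set.mem_empty_iff_false, if_false, Finset.sum_const_zero]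
    positivity
  have hlam : 0 < lam := by
    rcases hlam0.eq_or_lt with h0 | h0
    · rw [← h0] at hsmall; simp at hsmall; linarith
    · exact h0
  set x := Real.exp lam with hx
  have hpow : ∀ m : ℕ, Real.exp (m * lam) = x ^ m := fun m => Real.exp_nat_mul lam m
  have h2 : Real.exp (2 * lam) = x ^ 2 := by exact_mod_cast hpow 2
  have h4 : Real.exp (4 * lam) = x ^ 4 := by exact_mod_cast hpow 4
  have h14 : Real.exp (14 * lam) = x ^ 14 := by exact_mod_cast hpow 14
  have hx1 : 1 ≤ x := Real.one_le_exp hlam.le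
  have hx0 : 0 < x := by linarith
  have hlx : lam ≤ x := by linarith [Real.add_one_le_exp lam]
  have hlx2 : lam ^ 2 ≤ x ^ 2 := pow_le_pow_left₀ hlam.le hlx 2
  have hη2 : η ^ 2 ≤ 144 * lam ^ 2 * k := by
    calc η ^ 2 ≤ (12 * lam * √(k : ℝ)) ^ 2 := pow_le_pow_left₀ hη.le hsmall 2
      _ = 144 * lam ^ 2 * k := by rw [mul_pow, Real.sq_sqrt hk.le]; ring
  rw [h14, ← mul_div_assoc, div_le_iff₀ (by positivity)] at hN
  set Q := lam ^ 2 * (k : ℝ) ^ 4 * x ^ 14 * L with hQ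
  have hQ0 : 0 < Q := by positivity
  have hNr : (0 : ℝ) < N := by
    by_contra hcon
    have h0 : (N : ℝ) = 0 := le_antisymm (not_lt.mp hcon) (Nat.cast_nonneg _)
    rw [h0, zero_mul] at hN
    linarith
  have hNpos : 0 < N := by exact_mod_cast hNr
  have hA : 8 * (10 * L) ≤ N * ((Real.exp (2 * lam) * k)⁻¹) ^ 2 := by
    rw [h2, inv_pow, ← div_eq_mul_inv, le_div_iff₀ (by positivity)]
    refine le_of_mul_le_mul_right ?_ (pow_pos hη 4)
    refine le_trans ?_ hN
    calc 8 * (10 * L) * (x ^ 2 * k) ^ 2 * η ^ 4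
        = 80 * L * x ^ 4 * k ^ 2 * (η ^ 2) ^ 2 := by ring
      _ ≤ 80 * L * x ^ 4 * k ^ 2 * (144 * lam ^ 2 * k) ^ 2 := by gcongr
      _ = 1658880 * (L * x ^ 4 * k ^ 4 * lam ^ 2) * lam ^ 2 := by ring
      _ ≤ 1658880 * (L * x ^ 4 * k ^ 4 * lam ^ 2) * x ^ 10 := by
          gcongr
          exact hlx2.trans (pow_le_pow_right₀ hx1 (by norm_num))
      _ = 1658880 * Q := by rw [hQ]; ring
      _ ≤ 2 ^ 50 * Q := by gcongr; norm_num
  have hC : 2 ^ 50 * Q / η ^ 2 ≤ η ^ 2 * N := by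
    rw [div_le_iff₀ (by positivity)]
    refine hN.trans (le_of_eq (by ring))
  rcases le_total η (1024 * Real.exp (4 * lam)) with hmod | hlarge
  · refine (iidProb_overshoot_le_of_small M hM hlam hη hsmall hij h b hNpos
      (B := 10 * L) (by linarith) ?_).trans ?_
    · have hm : η ≤ 1024 * x ^ 4 * min η 1 := by
        rw [h4] at hmod
        have : 1 ≤ x ^ 4 := one_le_pow₀ hx1
        rcases le_total η 1 with h1 | h1
        · rw [min_eq_left h1]; nlinarith
        · rw [min_eq_right h1]; linarith
      have hm2 : η ^ 2 ≤ 2 ^ 20 * x ^ 8 * min η 1 ^ 2 := by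
        refine (pow_le_pow_left₀ hη.le hm 2).trans (le_of_eq (by ring))
      rw [h2, inv_pow, ← div_eq_mul_inv, ← mul_div_assoc, le_div_iff₀ (by positivity)]
      have hmin : 0 < min η 1 := lt_min hη one_pos
      calc 10 * L * (2 ^ 22 * lam ^ 2 * k) * (x ^ 2 * k) ^ 3
          ≤ min η 1 ^ 2 * (2 ^ 50 * Q / η ^ 2) := by
            rw [← mul_div_assoc, le_div_iff₀ (by positivity)]
            calc 10 * L * (2 ^ 22 * lam ^ 2 * k) * (x ^ 2 * k) ^ 3 * η ^ 2
                ≤ 10 * L * (2 ^ 22 * lam ^ 2 * k) * (x ^ 2 * k) ^ 3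
                  * (2 ^ 20 * x ^ 8 * min η 1 ^ 2) := by gcongr
              _ = min η 1 ^ 2 * (10 * 2 ^ 42 * Q) := by rw [hQ]; ring
              _ ≤ min η 1 ^ 2 * (2 ^ 50 * Q) := by gcongr; norm_num
        _ ≤ min η 1 ^ 2 * (η ^ 2 * N) := by gcongr
        _ = η ^ 2 * min η 1 ^ 2 * N := by ring
    · gcongr
      linarith
  · refine (iidProb_overshoot_le_of_large M hM hlam hlarge hij h b hNpos
      (B := 10 * L) (by linarith) hA ?_).trans ?_
    · rw [h2, h4, inv_pow, ← div_eq_mul_inv, ← mul_div_assoc, le_div_iff₀ (by positivity)]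
      refine le_trans ?_ hC
      rw [le_div_iff₀ (by positivity)]
      calc 2 ^ 19 * x ^ 4 * lam ^ 2 * k * (10 * L) * (x ^ 2 * k) ^ 2 * η ^ 2
          ≤ 2 ^ 19 * x ^ 4 * lam ^ 2 * k * (10 * L) * (x ^ 2 * k) ^ 2
            * (144 * lam ^ 2 * k) := by gcongr
        _ = 754974720 * (lam ^ 2 * k ^ 4 * x ^ 8 * L) * lam ^ 2 := by ring
        _ ≤ 754974720 * (lam ^ 2 * k ^ 4 * x ^ 8 * L) * x ^ 6 := by
            gcongr
            exact hlx2.trans (pow_le_pow_right₀ hx1 (by norm_num))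
        _ = 754974720 * Q := by rw [hQ]; ring
        _ ≤ 2 ^ 50 * Q := by gcongr; norm_num
    · rw [← mul_assoc]
      exact mul_le_mul_of_nonneg_right (by linarith) hE.le

/-- The samples for which no minimizer overshoots anywhere. -/
def typical (M : Model n k) (N : ℕ) (lam η : ℝ) : Set (Fin N → Fin n → Fin k) :=
  {z | ∀ i α β j b, α ≠ β → j ≠ i → z ∉ overshoot M N lam η i α β j b}

lemma iidProb_compl_typical_le (M : Model n k) {lam η ρ : ℝ} (hM : M.width ≤ lam) (hη : 0 < η)
    (hρ0 : 0 < ρ) (hρ1 : ρ < 1)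
    (hN : 2 ^ 50 * (lam ^ 2 * (k : ℝ) ^ 4 * Real.exp (14 * lam)
      * Real.log ((n : ℝ) * (k : ℝ) / ρ) / η ^ 4) ≤ N) :
    iidProb M.weight N (typical M N lam η)ᶜ ≤ ρ := by
  have hμ := fun z => (M.weight_pos z).le
  set A : Fin n × Fin k × Fin k × Fin n × Fin k → Set (Fin N → Fin n → Fin k) := fun q =>
    {z | q.2.1 ≠ q.2.2.1 ∧ q.2.2.2.1 ≠ q.1
      ∧ z ∈ overshoot M N lam η q.1 q.2.1 q.2.2.1 q.2.2.2.1 q.2.2.2.2} with hA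
  have hsub : (typical M N lam η)ᶜ ⊆ ⋃ q, A q := by
    intro z hz
    simp only [typical, Set.mem_compl_iff, Set.mem_ofPred_eq, not_forall, not_not] at hz
    obtain ⟨i, α, β, j, b, h1, h2, h3⟩ := hz
    exact Set.mem_iUnion.mpr ⟨(i, α, β, j, b), h1, h2, h3⟩
  refine (iidProb_mono hμ hsub).trans ?_
  by_cases hnk : 2 ≤ n ∧ 1 ≤ k
  · have hn2 : (2 : ℝ) ≤ n := by exact_mod_cast hnk.1
    have hk1 : (1 : ℝ) ≤ k := by exact_mod_cast hnk.2
    set m : ℝ := n * k with hm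
    have hm2 : 2 ≤ m := by nlinarith
    have hm0 : 0 < m := by linarith
    have hL : 0 < Real.log (m / ρ) := Real.log_pos (by rw [lt_div_iff₀ hρ0]; linarith)
    have hexp : Real.exp (-(10 * Real.log (m / ρ))) = (ρ / m) ^ 10 := by
      rw [Real.exp_neg, ← Real.exp_log (div_pos hm0 hρ0), ← Real.exp_log (div_pos hρ0 hm0),
        Real.log_exp, ← Real.exp_nat_mul, ← Real.exp_neg, Real.log_div hm0.ne' hρ0.ne',
        Real.log_div hρ0.ne' hm0.ne']
      congr 1
      push_cast
      ring
    have hq : ∀ q, iidProb M.weight N (A q) ≤ 8 * m * (ρ / m) ^ 10 := by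
      intro q
      by_cases h1 : q.2.1 ≠ q.2.2.1 ∧ q.2.2.2.1 ≠ q.1
      · rw [← hexp]
        exact (iidProb_mono hμ fun z hz => hz.2.2).trans
          (iidProb_overshoot_le M hM hη hL hN h1.2 h1.1 _)
      · have : A q = ∅ := Set.eq_empty_of_forall_notMem fun z hz => h1 ⟨hz.1, hz.2.1⟩
        rw [this]
        simp only [iidProb, Set.mem_empty_iff_false, if_false, Finset.sum_const_zero]
        positivity
    refine (iidProb_iUnion_le hμ A hq).trans ?_
    simp only [Fintype.card_prod, Fintype.card_fin]
    push_cast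
    -- There are at most `m³` entries, each failing with probability at most `8 m (ρ / m)^10`; the
    -- exponent `10` leaves `m⁶ ≥ 2⁶` to absorb the factor `8`.
    calc (n : ℝ) * (k * (k * (n * k))) * (8 * m * (ρ / m) ^ 10)
        ≤ m ^ 3 * (8 * m * (ρ / m) ^ 10) := by
          gcongr
          calc (n : ℝ) * (k * (k * (n * k))) = m * m * k := by rw [hm]; ring
            _ ≤ m * m * m := by
                gcongr
                rw [hm]; nlinarith
            _ = m ^ 3 := by ring
      _ = ρ * (8 * ρ ^ 9 / m ^ 6) := by field_simp
      _ ≤ ρ * 1 := by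
          gcongr
          rw [div_le_one (by positivity)]
          calc 8 * ρ ^ 9 ≤ 8 * 1 := by gcongr; exact pow_le_one₀ hρ0.le hρ1.le
            _ ≤ 2 ^ 6 := by norm_num
            _ ≤ m ^ 6 := by gcongr
      _ = ρ := mul_one ρ
  -- With at most one variable there is no pair `j ≠ i`, so no bad event. This also disposes of `n =
  -- 0`, where the logarithm is taken at zero.
  · have hn : n ≤ 1 := by
      have := NeZero.one_le (n := k)
      by_contra hcon
      exact hnk ⟨by omega, this⟩
    refine (iidProb_iUnion_le hμ A (B := 0) fun q => ?_).trans (by rw [mul_zero]; exact hρ0.le)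
    have : A q = ∅ := Set.eq_empty_of_forall_notMem fun z hz =>
      hz.2.1 (Fin.ext (by omega))
    rw [this]
    simp [iidProb]

lemma abs_center_sub_le (M : Model n k) {lam η : ℝ} {z : Fin N → Fin n → Fin k}
    (hz : z ∈ typical M N lam η) {i j : Fin n} (hij : j ≠ i) {α β : Fin k} (h : α ≠ β)
    (b : Fin k) {w : Matrix (Fin n) (Fin k) ℝ} (hw : IsConstrainedMinimizer lam z i α β w) :
    |center i w j b - (M.W i j α b - M.W i j β b)| ≤ η / 2 := by
  rw [abs_le]
  constructor
  · by_contra hcon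
    refine hz i β α j b h.symm hij ⟨-w, hw.swap h, ?_⟩
    rw [center_neg hij]
    linarith
  · by_contra hcon
    exact hz i α β j b h hij ⟨w, hw, not_le.mp hcon⟩

/-- On typical samples every output approximates the weights. -/
lemma IsOutput.abs_sub_lt (M : Model n k) {lam η : ℝ} (hη : 0 < η)
    {z : Fin N → Fin n → Fin k} (hz : z ∈ typical M N lam η)
    {What : Fin n → Fin n → Matrix (Fin k) (Fin k) ℝ} {Ghat : SimpleGraph (Fin n)}
    (hout : IsOutput lam η z What Ghat) {i j : Fin n} (hij : i ≠ j) (a b : Fin k) :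
    |M.W i j a b - What i j a b| < η / 2 := by
  have hk : (0 : ℝ) < k := by exact_mod_cast NeZero.pos k
  obtain ⟨w, hw, hWhat, -⟩ := hout
  -- Vanishing column sums make the average of the differences over all `β` equal to the entry. The
  -- term `β = a` is zero, so only `k - 1` errors of size `η / 2` are averaged over `k`, which makes
  -- the final inequality strict.
  have hW : M.W i j a b
      = 1 / (k : ℝ) * ∑ β ∈ Finset.univ.erase a, (M.W i j a b - M.W i j β b) := by
    have h1 : ∑ β, (M.W i j a b - M.W i j β b) = k * M.W i j a b := by
      rw [Finset.sum_sub_distrib, M.col_zero i j hij b]; simp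
    rw [← Finset.add_sum_erase _ _ (Finset.mem_univ a), sub_self, zero_add] at h1
    rw [h1]; field_simp
  rw [hWhat i j hij a b, hW, ← mul_sub, ← Finset.sum_sub_distrib, abs_mul,
    abs_of_pos (one_div_pos.mpr hk), one_div, inv_mul_lt_iff₀ hk]
  calc |∑ β ∈ Finset.univ.erase a, (M.W i j a b - M.W i j β b - center i (w i a β) j b)|
      ≤ ∑ β ∈ Finset.univ.erase a, η / 2 := by
        refine (Finset.abs_sum_le_sum_abs _ _).trans (Finset.sum_le_sum fun β hβ => ?_)
        rw [abs_sub_comm]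
        have hne := (Finset.ne_of_mem_erase hβ).symm
        exact abs_center_sub_le M hz hij.symm hne b (hw i a β hne)
    _ = (k - 1) * (η / 2) := by
        rw [Finset.sum_const, Finset.card_erase_of_mem (Finset.mem_univ a), Finset.card_univ,
          Fintype.card_fin, nsmul_eq_mul, Nat.cast_sub NeZero.one_le, Nat.cast_one]
    _ < k * (η / 2) := by linarith

/-! ### Recovery of the graph by thresholding -/

omit [NeZero k] in
lemma abs_le_maxAbs (A : Matrix (Fin k) (Fin k) ℝ) (a b : Fin k) : |A a b| ≤ maxAbs A :=
  le_ciSup (f := fun p : Fin k × Fin k => |A p.1 p.2|) (Set.finite_range _).bddAbove (a, b)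

lemma exists_abs_eq_maxAbs (A : Matrix (Fin k) (Fin k) ℝ) : ∃ a b, |A a b| = maxAbs A := by
  obtain ⟨p, hp⟩ := exists_eq_ciSup_of_finite (f := fun p : Fin k × Fin k => |A p.1 p.2|)
  exact ⟨p.1, p.2, hp⟩

/-- Thresholding an entrywise approximation recovers the dependency graph. -/
lemma thresholdGraph_eq (M : Model n k) {η : ℝ} (hmin : (η : EReal) ≤ M.minEdgeWeight)
    {What : Fin n → Fin n → Matrix (Fin k) (Fin k) ℝ}
    (h : ∀ i j, i ≠ j → ∀ a b, |M.W i j a b - What i j a b| < η / 2) :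
    thresholdGraph η What = M.graph := by
  have key : ∀ i j, i ≠ j → (η / 2 ≤ maxAbs (What i j) ↔ M.graph.Adj i j) := by
    intro i j hij
    constructor
    · intro hle
      refine ⟨hij, fun h0 => ?_⟩
      obtain ⟨a, b, hab⟩ := exists_abs_eq_maxAbs (What i j)
      have h1 := h i j hij a b
      rw [h0, Matrix.zero_apply, zero_sub, abs_neg, hab] at h1
      linarith
    · intro hadj
      have h1 : (η : EReal) ≤ (maxAbs (M.W i j) : ℝ) :=
        hmin.trans (iInf₂_le_of_le i j (iInf_le _ hadj))
      have h2 : η ≤ maxAbs (M.W i j) := by exact_mod_cast h1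
      obtain ⟨a, b, hab⟩ := exists_abs_eq_maxAbs (M.W i j)
      have h3 := h i j hij a b
      have h4 := abs_sub_abs_le_abs_sub (M.W i j a b) (What i j a b)
      have h5 := abs_le_maxAbs (What i j) a b
      linarith
  ext i j
  rw [thresholdGraph, SimpleGraph.fromRel_adj]
  constructor
  · rintro ⟨hij, h1 | h1⟩
    · exact (key i j hij).mp h1.2
    · exact ((key j i hij.symm).mp h1.2).symm
  · intro hadj
    have hij := hadj.ne
    rcases lt_or_gt_of_ne hij with h1 | h1
    · exact ⟨hij, Or.inl ⟨h1, (key i j hij).mpr hadj⟩⟩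
    · exact ⟨hij, Or.inr ⟨h1, (key j i hij.symm).mpr hadj.symm⟩⟩

lemma exists_isOutput (M : Model n k) {lam : ℝ} (hM : M.width ≤ lam) (η : ℝ)
    (z : Fin N → Fin n → Fin k) : ∃ What Ghat, IsOutput lam η z What Ghat := by
  choose w hw using fun i α β =>
    exists_isConstrainedMinimizer (M.nonneg_of_width_le hM i) z i α β
  exact ⟨fun i j α b => (1 / (k : ℝ)) * ∑ β ∈ Finset.univ.erase α, center i (w i α β) j b, _,
    w, fun i α β _ => hw i α β, fun _ _ _ _ _ => rfl, rfl⟩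

end

end PairwiseLearning

end

theorem mainTheorem4 :
    ∃ C : ℝ, 0 < C ∧
      ∀ (n k : ℕ) [NeZero k] (M : PairwiseLearning.Model n k) (lam η ρ : ℝ) (N : ℕ),
        M.width ≤ lam →
        0 < η → (η : EReal) ≤ M.minEdgeWeight →
        0 < ρ → ρ < 1 →
        C * (lam ^ 2 * (k : ℝ) ^ 4 * Real.exp (14 * lam) * Real.log ((n : ℝ) * (k : ℝ) / ρ) / η ^ 4)
          ≤ (N : ℝ) →
        ENNReal.ofReal (1 - ρ) ≤
          (MeasureTheory.Measure.pi fun _ : Fin N => M.dist.toMeasure)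
            {z | (∃ What Ghat, PairwiseLearning.IsOutput lam η z What Ghat) ∧
              ∀ What Ghat, PairwiseLearning.IsOutput lam η z What Ghat →
                (∀ i j, i ≠ j → ∀ a b, |M.W i j a b - What i j a b| < η / 2) ∧
                Ghat = M.graph} := by
  -- The most demanding requirement, from the regime of moderate `η`, is `10 * 2 ^ 42`.
  refine ⟨2 ^ 50, by positivity, ?_⟩
  intro n k _ M lam η ρ N hM hη hmin hρ0 hρ1 hN
  rw [M.pi_dist_apply]
  refine ENNReal.ofReal_le_ofReal ?_
  have hbad := PairwiseLearning.iidProb_compl_typical_le M hM hη hρ0 hρ1 hN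
  rw [PairwiseLearning.iidProb_compl M.sum_weight] at hbad
  refine le_trans (by linarith) (PairwiseLearning.iidProb_mono
    (A := PairwiseLearning.typical M N lam η) (fun z => (M.weight_pos z).le) ?_)
  intro z hz
  refine ⟨PairwiseLearning.exists_isOutput M hM η z, fun What Ghat hout => ?_⟩
  have happrox : ∀ i j, i ≠ j → ∀ a b, |M.W i j a b - What i j a b| < η / 2 :=
    fun i j hij a b => hout.abs_sub_lt M hη hz hij a b
  obtain ⟨-, -, -, hG⟩ := hout
  exact ⟨happrox, hG.trans (PairwiseLearning.thresholdGraph_eq M hmin happrox)⟩
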